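/- Let $d,n\ge 1$ be integers, $0\le s<1$, $\Omega=(0,1)^d$. For $f:\Omega\to\mathbb R$ write $\|f\|_{n,\infty}=\max_{|\alpha|\le n}\|D^\alpha f\|_{L^\infty(\Omega)}$ (weak derivatives), let $W^{n,\infty}(\Omega)$ be the corresponding Sobolev space, and put $\|f\|_{s,\infty}=\max\{\|f\|_{L^\infty(\Omega)},\ \operatorname{ess\,sup}_{x,x'\in\Omega}|f(x)-f(x')|/|x-x'|^s\}$ if $0<s<1$ and $\|f\|_{0,\infty}=\|f\|_{L^\infty(\Omega)}$. For a symmetric positive definite matrix $\Gamma\in\mathbb R^{D\times D}$ and a forward map $\mathcal G:\Omega\to\mathbb R^D$ let $$\Phi(y;\theta)=\tfrac12\,(y-\mathcal G(\theta))^{\top}\Gamma^{-1}(y-\mathcal G(\theta)),\qquad y\in\mathbb R^D,\ \theta\in\Omega,$$ and let $\pi(\cdot;\theta)\propto\exp(-\Phi(\cdot;\theta))$ be the corresponding likelihood, a probability density in $y\in\mathbb R^D$. For an emulator $\mathcal G^e:\mathbb R^d\to\mathbb R^D$ define $\Phi^e$ and $\pi^e$ in the same way, with $\mathcal G^e$ in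 place of $\mathcal G$ (and the same $\Gamma$). The Hellinger distance of densities is $d_H(p,q)=\big(\tfrac12\int(\sqrt p-\sqrt q)^2\,dy\big)^{1/2}$. A standard ReLU network is a feed-forward network without skip connections, $F_{K-1}\circ\dots\circ F_0$, whose layers are affine maps followed by the componentwise ReLU, except that the last layer is affine; $K$ is its depth. We say that it has size constant $c$ at accuracy $\varepsilon$ if $$K\le c\,\log\big(\varepsilon^{-n/(n-s)}\big),\qquad N\le c\,\varepsilon^{-d/(n-s)}\log^2\big(\varepsilon^{-n/(n-s)}\big),$$ where $N$ is the number of its nonzero weights and biases plus the number of its ReLU units. **Theorem.** There is a constant $c=c(d,n,s)>0$ such that for all $D$, all symmetric positive definite $\Gamma\in\mathbb R^{D\times D}$ and all $M,B$ there are constants $C,c'>0$ (depending only on $d,n,s,D,\Gamma,M,B$) with the following property. Let $\mathcal G=(\mathcal G_1,\dots,\mathcal G_D)$ with $\mathcal G_j\in W^{n,\infty}(\Omega)$ and $\|\mathcal G_j\|_{n,\infty}\le B$ for $j=1,\dots,D$, and let $\varepsilon\in(0,1/2)$. 1. There is a standard ReLU network $\mathcal G^e$ with size constant $c$ at accuracy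 $\varepsilon$ such that $\|\Phi(y;\cdot)-\Phi^e(y;\cdot)\|_{s,\infty}\le C\varepsilon$ for all $y$ with $\max_i|y_i|\le M$, and $$d_H\big(\pi(\cdot;\theta),\pi^e(\cdot;\theta)\big)\le C\varepsilon\quad\text{for almost every }\theta\in\Omega .$$ 2. There is a standard ReLU network $\mathcal G^e$ with size constant $c'$ at accuracy $\varepsilon$ such that $\|\Phi(y;\cdot)-\Phi^e(y;\cdot)\|_{s,\infty}\le\varepsilon$ for all $y$ with $\max_i|y_i|\le M$, and again $d_H(\pi(\cdot;\theta),\pi^e(\cdot;\theta))\le C\varepsilon$ for almost every $\theta\in\Omega$. -/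

import Mathlib

open MeasureTheory Set
open scoped ENNReal ContDiff Matrix

noncomputable section

namespace FBNN

/-- The parameter domain `Ω = (0,1)^d`, inside `ℝ^d` with its Euclidean norm. -/
def cube (d : ℕ) : Set (EuclideanSpace ℝ (Fin d)) :=
  {θ | ∀ i, θ i ∈ Ioo (0 : ℝ) 1}

/-- Lebesgue measure on `Ω`. -/
def cubeMeasure (d : ℕ) : Measure (EuclideanSpace ℝ (Fin d)) :=
  volume.restrict (cube d)

/-! ### Sobolev spaces on the cube -/

/-- The classical `i`-th partial derivative. -/
def partialDeriv {d : ℕ} (i : Fin d) (φ : EuclideanSpace ℝ (Fin d) → ℝ) :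
    EuclideanSpace ℝ (Fin d) → ℝ :=
  fun x => fderiv ℝ φ x (EuclideanSpace.single i 1)

/-- The classical derivative `D^α φ` for a multi-index `α` (used for smooth `φ` only, so that the
order of the partial derivatives is irrelevant). -/
def multiDeriv {d : ℕ} (α : Fin d → ℕ) (φ : EuclideanSpace ℝ (Fin d) → ℝ) :
    EuclideanSpace ℝ (Fin d) → ℝ :=
  (List.finRange d).foldr (fun i ψ => (partialDeriv i)^[α i] ψ) φ

/-- `g` is a weak derivative `D^α f` of `f` on `Ω`. -/
def IsWeakDeriv {d : ℕ} (α : Fin d → ℕ) (f g : EuclideanSpace ℝ (Fin d) → ℝ) : Prop :=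
  LocallyIntegrableOn f (cube d) ∧ LocallyIntegrableOn g (cube d) ∧
    ∀ φ : EuclideanSpace ℝ (Fin d) → ℝ,
      ContDiff ℝ ∞ φ → HasCompactSupport φ → tsupport φ ⊆ cube d →
        ∫ x in cube d, f x * multiDeriv α φ x
          = (-1) ^ (∑ i, α i) * ∫ x in cube d, g x * φ x

/-- `f ∈ W^{n,p}(Ω)`. -/
def MemSobolev {d : ℕ} (n : ℕ) (p : ℝ≥0∞) (f : EuclideanSpace ℝ (Fin d) → ℝ) : Prop :=
  MemLp f p (cubeMeasure d) ∧
    ∀ α : Fin d → ℕ, ∑ i, α i ≤ n → ∃ g, IsWeakDeriv α f g ∧ MemLp g p (cubeMeasure d)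

/-- `‖f‖_{n,∞} = max_{|α| ≤ n} ‖D^α f‖_∞`. Weak derivatives are unique up to null sets, so the
infimum over `g` is the common value of `‖g‖_∞` (and `∞` if there is no weak derivative). -/
def sobolevNormTop {d : ℕ} (n : ℕ) (f : EuclideanSpace ℝ (Fin d) → ℝ) : ℝ≥0∞ :=
  ⨆ (α : Fin d → ℕ) (_ : ∑ i, α i ≤ n),
    ⨅ (g : EuclideanSpace ℝ (Fin d) → ℝ) (_ : IsWeakDeriv α f g), eLpNorm g ∞ (cubeMeasure d)

/-- The Sobolev–Slobodeckij norm `‖f‖_{s,∞}` on `Ω`, `0 ≤ s < 1`; for `s = 0` it is `‖f‖_∞`. -/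
def slobodeckijNormTop {d : ℕ} (s : ℝ) (f : EuclideanSpace ℝ (Fin d) → ℝ) : ℝ≥0∞ :=
  if s = 0 then eLpNorm f ∞ (cubeMeasure d)
  else max (eLpNorm f ∞ (cubeMeasure d))
    (eLpNorm (fun z : EuclideanSpace ℝ (Fin d) × EuclideanSpace ℝ (Fin d) =>
      (f z.1 - f z.2) / ‖z.1 - z.2‖ ^ s) ∞ ((cubeMeasure d).prod (cubeMeasure d)))

/-! ### Standard ReLU networks -/

/-- Standard (feed-forward, without skip connections) networks with `k` outputs; the index is the
number of inputs. The last layer is affine, every other layer is affine followed by the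
componentwise ReLU. -/
inductive ReLUNet (k : ℕ) : ℕ → Type
  | output {m : ℕ} (W : Matrix (Fin k) (Fin m) ℝ) (b : Fin k → ℝ) : ReLUNet k m
  | hidden {m h : ℕ} (W : Matrix (Fin h) (Fin m) ℝ) (b : Fin h → ℝ) (rest : ReLUNet k h) :
      ReLUNet k m

namespace ReLUNet

/-- The function computed by the network. -/
def eval {k : ℕ} : {m : ℕ} → ReLUNet k m → (Fin m → ℝ) → (Fin k → ℝ)
  | _, output W b, x => W *ᵥ x + b
  | _, hidden W b rest, x => rest.eval (fun i => max 0 ((W *ᵥ x + b) i))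

/-- The depth: the number `K` of layers. -/
def depth {k : ℕ} : {m : ℕ} → ReLUNet k m → ℕ
  | _, output _ _ => 1
  | _, hidden _ _ rest => rest.depth + 1

/-- The number of nonzero entries of a weight matrix and a bias vector. -/
def layerWeights {k m : ℕ} (W : Matrix (Fin k) (Fin m) ℝ) (b : Fin k → ℝ) : ℕ :=
  {q : Fin k × Fin m | W q.1 q.2 ≠ 0}.ncard + {i : Fin k | b i ≠ 0}.ncard

/-- The number of (nonzero) weights, biases included. -/
def numWeights {k : ℕ} : {m : ℕ} → ReLUNet k m → ℕ
  | _, output W b => layerWeights W b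
  | _, hidden W b rest => layerWeights W b + rest.numWeights

/-- The number of ReLU units. -/
def numUnits {k : ℕ} : {m : ℕ} → ReLUNet k m → ℕ
  | _, output _ _ => 0
  | _, hidden (h := h) _ _ rest => h + rest.numUnits

/-- Depth at most `c log(ε^{-n/(n-s)})`, and number of weights and units at most
`c ε^{-d/(n-s)} log²(ε^{-n/(n-s)})`. -/
def SizeBound {k d : ℕ} (net : ReLUNet k d) (n : ℕ) (s c ε : ℝ) : Prop :=
  (net.depth : ℝ) ≤ c * Real.log (ε ^ (-((n : ℝ) / (n - s)))) ∧
  ((net.numWeights + net.numUnits : ℕ) : ℝ)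
    ≤ c * ε ^ (-((d : ℝ) / (n - s))) * Real.log (ε ^ (-((n : ℝ) / (n - s)))) ^ 2

/-- The network as a map on the parameter space `ℝ^d`. -/
def toMap {k d : ℕ} (net : ReLUNet k d) : EuclideanSpace ℝ (Fin d) → Fin k → ℝ :=
  fun θ => net.eval (fun i => θ i)

end ReLUNet

/-! ### Potentials, likelihoods and the Hellinger distance -/

/-- The potential `Φ(y; θ) = ½ ‖y - 𝒢(θ)‖_Γ²`, where `‖v‖_Γ² = vᵀ Γ⁻¹ v`. -/
def potential {d D : ℕ} (Γ : Matrix (Fin D) (Fin D) ℝ)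
    (G : EuclideanSpace ℝ (Fin d) → Fin D → ℝ) (y : Fin D → ℝ)
    (θ : EuclideanSpace ℝ (Fin d)) : ℝ :=
  (1 / 2) * ((y - G θ) ⬝ᵥ (Γ⁻¹ *ᵥ (y - G θ)))

/-- The likelihood `π(· ; θ) ∝ exp(-Φ(· ; θ))`, a probability density in `y ∈ ℝ^D` with respect
to Lebesgue measure. -/
def likelihood {d D : ℕ} (Γ : Matrix (Fin D) (Fin D) ℝ)
    (G : EuclideanSpace ℝ (Fin d) → Fin D → ℝ) (θ : EuclideanSpace ℝ (Fin d))
    (y : Fin D → ℝ) : ℝ :=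
  Real.exp (-potential Γ G y θ) / ∫ z : Fin D → ℝ, Real.exp (-potential Γ G z θ)

/-- The Hellinger distance of two densities: `d_H(p, q)² = ½ ∫ (√p - √q)² dμ`. -/
def hellingerDist {Y : Type*} [MeasurableSpace Y] (μ : Measure Y) (p q : Y → ℝ) : ℝ≥0∞ :=
  (2⁻¹ * ∫⁻ y, ENNReal.ofReal ((√(p y) - √(q y)) ^ 2) ∂μ) ^ (1 / 2 : ℝ)

end FBNN

end

/-!
A function in `W^{n,∞}(Ω)` is almost everywhere the limit of its mollifications, which are smooth
with derivatives up to order `n` bounded by the Sobolev norm on cubes exhausting `Ω`. Gluing their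
Taylor polynomials at the points of a grid of mesh `1 / N` by a partition of unity of hat functions
leaves an error of size `N ^ (-n)` that is Lipschitz with constant `N ^ (1 - n)`, hence of size
`N ^ (s - n)` in the Hölder norm. The coefficients are bounded uniformly, so a subsequence of them
converges and the estimate survives the limit.

The glued Taylor polynomials are combinations of products of hat functions, and a ReLU network
evaluates such products by Yarotsky's method: multiplication reduces to squaring, and `t - t ^ 2` is
the sum of `h^[k] t / 4 ^ k` over `k ≥ 1` for the tent map `h`, so that depth `O(log N)` is enough.
Since `(y - a)ᵀ Γ⁻¹ (y - a)` is a quadratic form and the Hellinger distance of two Gaussians with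
precision `A` and means `a`, `b` is `√(1 - exp (-(a - b)ᵀ A (a - b) / 8))`, potentials and
likelihoods inherit the error of the forward map up to a constant `C`. Accuracy `ε` without a
constant is obtained from accuracy `ε / C`, at the price of a larger size constant.
-/

namespace FBNN

noncomputable section

/-! ### ReLU networks from affine functionals -/

theorem ReLUNet.layerWeights_le {k m r : ℕ} (W : Matrix (Fin k) (Fin m) ℝ) (b : Fin k → ℝ)
    (hr : ∀ i, {j | W i j ≠ 0}.ncard ≤ r) : layerWeights W b ≤ k * r + k := by
  have hrows : {q : Fin k × Fin m | W q.1 q.2 ≠ 0}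
      = ⋃ i ∈ Finset.univ, Prod.mk i '' {j | W i j ≠ 0} := by
    ext ⟨i, j⟩
    simp
  have hweights : {q : Fin k × Fin m | W q.1 q.2 ≠ 0}.ncard ≤ k * r := by
    rw [hrows]
    refine (Finset.set_ncard_biUnion_le _ _).trans ?_
    refine (Finset.sum_le_card_nsmul _ _ r fun i _ => ?_).trans (by simp)
    exact (Set.ncard_image_le (Set.toFinite _)).trans (hr i)
  exact add_le_add hweights ((Set.ncard_le_card _).trans (by simp))

/-- The affine part of a layer with inputs indexed by `ι` and outputs indexed by `κ`: one affine
functional per output. -/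
abbrev AffineLayer (ι κ : Type*) := κ → (ι → ℝ) →ᵃ[ℝ] ℝ

namespace AffineLayer

variable {ι κ : Type*}

/-- The affine layer followed by the componentwise ReLU. -/
def relu (f : AffineLayer ι κ) (x : ι → ℝ) : κ → ℝ := fun i => max 0 (f i x)

theorem relu_apply (f : AffineLayer ι κ) (x : ι → ℝ) (i : κ) : f.relu x i = max 0 (f i x) := rfl

variable [DecidableEq ι]

/-- The weight matrix of an affine layer. -/
def weight (f : AffineLayer ι κ) : Matrix κ ι ℝ :=
  Matrix.of fun i j => (f i).linear (Pi.single j 1)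

/-- The bias vector of an affine layer. -/
def bias (f : AffineLayer ι κ) : κ → ℝ := fun i => f i 0

theorem weight_mulVec_add_bias [Fintype ι] (f : AffineLayer ι κ) (x : ι → ℝ) :
    f.weight *ᵥ x + f.bias = fun i => f i x := by
  funext i
  have hlinear : (f i).linear x = ∑ j, x j * (f i).linear (Pi.single j 1) := by
    conv_lhs => rw [← Finset.univ_sum_single x, map_sum]
    refine Finset.sum_congr rfl fun j _ => ?_
    rw [← smul_eq_mul, ← map_smul, ← Pi.single_smul, smul_eq_mul, mul_one]
  rw [AffineMap.decomp (f i)]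
  simp [weight, bias, Matrix.mulVec, dotProduct, hlinear, mul_comm]

theorem submatrix_weight_mulVec {m : ℕ} {κ' : Type*} (f : AffineLayer ι κ) (σ : κ' → κ)
    (e : ι ≃ Fin m) (x : ι → ℝ) :
    f.weight.submatrix σ e.symm *ᵥ (x ∘ e.symm) + f.bias ∘ σ = fun i => f (σ i) x := by
  have := Fintype.ofEquiv _ e.symm
  have hx : f.weight.submatrix σ e.symm *ᵥ (x ∘ e.symm) = (f.weight *ᵥ x) ∘ σ := by
    rw [Matrix.submatrix_mulVec_equiv]
    simp [Function.comp_assoc]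
  rw [hx, ← Pi.add_comp, weight_mulVec_add_bias]
  rfl

theorem ncard_submatrix_weight_row_le {m r : ℕ} {κ' : Type*} (f : AffineLayer ι κ) (σ : κ' → κ)
    (e : ι ≃ Fin m) (hr : ∀ i, {j | f.weight i j ≠ 0}.ncard ≤ r) (i : κ') :
    {j | f.weight.submatrix σ e.symm i j ≠ 0}.ncard ≤ r := by
  have hrow : {j | f.weight.submatrix σ e.symm i j ≠ 0} = e '' {j | f.weight (σ i) j ≠ 0} := by
    rw [Equiv.image_eq_preimage_symm]
    rfl
  rw [hrow, Set.ncard_image_of_injective _ e.injective]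
  exact hr _

end AffineLayer

/-- `F` is computed by a network of depth `K` with at most `w` weights and units, for every
enumeration of the input coordinates. -/
def Realizable {ι : Type*} {k : ℕ} (F : (ι → ℝ) → Fin k → ℝ) (K w : ℕ) : Prop :=
  ∀ (m : ℕ) (e : ι ≃ Fin m), ∃ net : ReLUNet k m,
    (∀ x, net.eval (x ∘ e.symm) = F x) ∧ net.depth = K ∧ net.numWeights + net.numUnits ≤ w

namespace Realizable

variable {ι κ : Type*} {k K w : ℕ}

theorem affine [Fintype ι] (f : AffineLayer ι (Fin k)) :
    Realizable (fun x i => f i x) 1 (k * Fintype.card ι + k) := by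
  classical
  intro m e
  refine ⟨.output (f.weight.submatrix id e.symm) (f.bias ∘ id),
    AffineLayer.submatrix_weight_mulVec f id e, rfl, ?_⟩
  exact ReLUNet.layerWeights_le _ _ (AffineLayer.ncard_submatrix_weight_row_le f id e
    fun i => (Set.ncard_le_card _).trans (by simp))

theorem comp_relu [DecidableEq ι] [Fintype κ] {F : (κ → ℝ) → Fin k → ℝ} (hF : Realizable F K w)
    (f : AffineLayer ι κ) {r : ℕ} (hr : ∀ i, {j | f.weight i j ≠ 0}.ncard ≤ r) :
    Realizable (fun x => F (f.relu x)) (K + 1) (w + Fintype.card κ * (r + 2)) := by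
  intro m e
  let σ := Fintype.equivFin κ
  obtain ⟨net, heval, hdepth, hsize⟩ := hF _ σ
  refine ⟨.hidden (f.weight.submatrix σ.symm e.symm)
    (f.bias ∘ σ.symm) net, fun x => ?_, ?_, ?_⟩
  · rw [ReLUNet.eval, AffineLayer.submatrix_weight_mulVec]
    exact heval (f.relu x)
  · rw [ReLUNet.depth, hdepth]
  · have hlayer := ReLUNet.layerWeights_le _ (f.bias ∘ σ.symm)
      (AffineLayer.ncard_submatrix_weight_row_le f σ.symm e hr)
    simp only [ReLUNet.numWeights, ReLUNet.numUnits]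
    linarith

end Realizable

/-- A composition of ReLU layers on a fixed set `J` of registers, first layer first. -/
abbrev ReLUProgram (J : Type*) := List (AffineLayer J J)

namespace ReLUProgram

variable {J : Type*}

/-- The registers after the execution of a program. -/
def run (P : ReLUProgram J) (x : J → ℝ) : J → ℝ := P.foldl (fun x f => f.relu x) x

@[simp]
theorem run_nil (x : J → ℝ) : run [] x = x := rfl

@[simp]
theorem run_cons (f : AffineLayer J J) (P : ReLUProgram J) (x : J → ℝ) :
    run (f :: P) x = run P (f.relu x) := rfl

theorem run_append (P Q : ReLUProgram J) (x : J → ℝ) : run (P ++ Q) x = run Q (run P x) :=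
  List.foldl_append

/-- The program `P` applied to every block of a family of copies of the registers. -/
def runBlocks {A : Type*} (P : ReLUProgram J) (X : A × J → ℝ) : A × J → ℝ :=
  fun q => P.run (fun j => X (q.1, j)) q.2

end ReLUProgram

theorem Realizable.comp_runBlocks {A J : Type*} [Fintype A] [Fintype J] {k K w : ℕ}
    {F : (A × J → ℝ) → Fin k → ℝ} (hF : Realizable F K w) (P : ReLUProgram J) :
    Realizable (fun X => F (P.runBlocks X)) (K + P.length)
      (w + P.length * (Fintype.card A * Fintype.card J * (Fintype.card J + 2))) := by
  classical
  induction P with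
  | nil => rw [List.length_nil, add_zero, zero_mul, add_zero]; exact hF
  | cons f P ih =>
    let fBlocks : AffineLayer (A × J) (A × J) := fun q =>
      (f q.2).comp (LinearMap.funLeft ℝ ℝ (Prod.mk q.1)).toAffineMap
    have hrow : ∀ q, {q' | fBlocks.weight q q' ≠ 0}.ncard ≤ Fintype.card J := by
      rintro ⟨a, j⟩
      have hsub : {q' | fBlocks.weight (a, j) q' ≠ 0} ⊆ Prod.mk a '' univ := by
        rintro ⟨a', j'⟩ hweight
        by_contra hne
        have ha : a ≠ a' := by simpa using hne
        have hzero : LinearMap.funLeft ℝ ℝ (Prod.mk a) (Pi.single (a', j') 1) = 0 := by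
          funext i
          simp [LinearMap.funLeft, ha]
        exact hweight (by simp [AffineLayer.weight, fBlocks, hzero])
      refine (Set.ncard_le_ncard hsub).trans ((Set.ncard_image_le).trans ?_)
      simp [Set.ncard_univ]
    have hcomp := ih.comp_relu fBlocks hrow
    rw [Fintype.card_prod, add_assoc, add_assoc, ← Nat.succ_mul] at hcomp
    exact hcomp

/-! ### Approximate multiplication on the unit interval -/

theorem abs_max_zero_sub_max_zero_le (a b : ℝ) : |max 0 a - max 0 b| ≤ |a - b| := by
  simpa using abs_max_sub_max_le_max 0 a 0 b

/-- The tent map of `[0,1]`, extended to a function that needs a single ReLU. -/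
def tent (t : ℝ) : ℝ := 2 * t - 4 * max 0 (t - 1 / 2)

theorem tent_eq (t : ℝ) : tent t = 1 - |2 * t - 1| := by
  unfold tent
  rcases le_total t (1 / 2) with h | h
  · rw [max_eq_left (by linarith), abs_of_nonpos (by linarith)]; ring
  · rw [max_eq_right (by linarith), abs_of_nonneg (by linarith)]; ring

theorem tent_mem {t : ℝ} (ht : t ∈ Icc (0 : ℝ) 1) : tent t ∈ Icc (0 : ℝ) 1 := by
  have habs : |2 * t - 1| ≤ 1 := abs_le.2 ⟨by linarith [ht.1], by linarith [ht.2]⟩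
  rw [tent_eq]
  exact ⟨by linarith, by linarith [abs_nonneg (2 * t - 1)]⟩

-- With `g t = t - t²` this is the functional equation `g t = (tent t + g (tent t)) / 4`.
theorem tent_add_tent_sub_sq (t : ℝ) : tent t + (tent t - tent t ^ 2) = 4 * (t - t ^ 2) := by
  rw [tent_eq]
  linear_combination -sq_abs (2 * t - 1)

theorem abs_tent_sub_tent_le (t u : ℝ) : |tent t - tent u| ≤ 2 * |t - u| := by
  calc |tent t - tent u| = |(|2 * u - 1| - |2 * t - 1|)| := by rw [tent_eq, tent_eq]; ring_nf
    _ ≤ |2 * u - 1 - (2 * t - 1)| := abs_abs_sub_abs_le_abs_sub _ _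
    _ = |2 * (u - t)| := by ring_nf
    _ = 2 * |t - u| := by rw [abs_mul, abs_two, abs_sub_comm]

/-- One step of the sawtooth recursion: the first component iterates the tent map, the second
one accumulates its values in base `4`. The outer `max 0` makes it a ReLU layer. -/
def sawtoothStep (p : ℝ × ℝ) : ℝ × ℝ := (max 0 (tent p.1), max 0 (4 * p.2 + tent p.1))

/-- Yarotsky's sawtooth approximation of `x - x²` on `[0,1]`. -/
def sqGap (k : ℕ) (x : ℝ) : ℝ := (sawtoothStep^[k] (x, 0)).2 / 4 ^ k

theorem sawtoothStep_iterate {x : ℝ} (hx : x ∈ Icc (0 : ℝ) 1) (k : ℕ) :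
    (sawtoothStep^[k] (x, 0)).1 ∈ Icc (0 : ℝ) 1 ∧ 0 ≤ (sawtoothStep^[k] (x, 0)).2 ∧
      4 ^ k * (x - x ^ 2) = (sawtoothStep^[k] (x, 0)).2
        + ((sawtoothStep^[k] (x, 0)).1 - (sawtoothStep^[k] (x, 0)).1 ^ 2) := by
  induction k with
  | zero => simpa using hx
  | succ k ih =>
    rw [Function.iterate_succ_apply']
    obtain ⟨htent, hacc, hgap⟩ := ih
    have hmem := tent_mem htent
    simp only [sawtoothStep]
    rw [max_eq_right hmem.1, max_eq_right (by linarith [hmem.1])]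
    refine ⟨hmem, by linarith [hmem.1], ?_⟩
    rw [pow_succ]
    linear_combination 4 * hgap - tent_add_tent_sub_sq (sawtoothStep^[k] (x, 0)).1

theorem sub_sq_sub_sqGap_mem {x : ℝ} (hx : x ∈ Icc (0 : ℝ) 1) (k : ℕ) :
    x - x ^ 2 - sqGap k x ∈ Icc (0 : ℝ) (1 / 4 * (1 / 4 ^ k)) := by
  obtain ⟨htent, -, hgap⟩ := sawtoothStep_iterate hx k
  have h4 : (0 : ℝ) < 4 ^ k := by positivity
  have heq : x - x ^ 2 - sqGap k x
      = ((sawtoothStep^[k] (x, 0)).1 - (sawtoothStep^[k] (x, 0)).1 ^ 2) * (1 / 4 ^ k) := by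
    rw [sqGap, mul_one_div, eq_div_iff h4.ne', sub_mul, div_mul_cancel₀ _ h4.ne']
    linarith
  rw [heq]
  constructor
  · exact mul_nonneg (by nlinarith [htent.1, htent.2]) (by positivity)
  · gcongr
    nlinarith [sq_nonneg ((sawtoothStep^[k] (x, 0)).1 - 1 / 2)]

theorem abs_sawtoothStep_iterate_sub_le (x y : ℝ) (k : ℕ) :
    |(sawtoothStep^[k] (x, 0)).1 - (sawtoothStep^[k] (y, 0)).1| ≤ 2 ^ k * |x - y| ∧
    |(sawtoothStep^[k] (x, 0)).2 - (sawtoothStep^[k] (y, 0)).2|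
      ≤ (4 ^ k - 2 ^ k) * |x - y| := by
  induction k with
  | zero => simp
  | succ k ih =>
    rw [Function.iterate_succ_apply', Function.iterate_succ_apply']
    set p := sawtoothStep^[k] (x, 0)
    set q := sawtoothStep^[k] (y, 0)
    have htent := abs_tent_sub_tent_le p.1 q.1
    refine ⟨(abs_max_zero_sub_max_zero_le _ _).trans ?_,
      (abs_max_zero_sub_max_zero_le _ _).trans ?_⟩
    · rw [pow_succ]; linarith [ih.1]
    · calc |4 * p.2 + tent p.1 - (4 * q.2 + tent q.1)|
          = |4 * (p.2 - q.2) + (tent p.1 - tent q.1)| := by ring_nf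
        _ ≤ 4 * |p.2 - q.2| + |tent p.1 - tent q.1| := by
            simpa [abs_mul] using abs_add_le (4 * (p.2 - q.2)) (tent p.1 - tent q.1)
        _ ≤ (4 ^ (k + 1) - 2 ^ (k + 1)) * |x - y| := by
            rw [pow_succ, pow_succ]; linarith [ih.1, ih.2]

theorem abs_sqGap_sub_sqGap_le (k : ℕ) (x y : ℝ) : |sqGap k x - sqGap k y| ≤ |x - y| := by
  have h4 : (0 : ℝ) < 4 ^ k := by positivity
  rw [sqGap, sqGap, ← sub_div, abs_div, abs_of_pos h4, div_le_iff₀ h4, mul_comm]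
  refine (abs_sawtoothStep_iterate_sub_le x y k).2.trans ?_
  gcongr
  exact sub_le_self _ (by positivity)

/-- The projection onto `[0,1]`, written with two ReLUs. -/
def clampUnit (t : ℝ) : ℝ := max 0 (1 - max 0 (1 - t))

theorem clampUnit_mem (t : ℝ) : clampUnit t ∈ Icc (0 : ℝ) 1 :=
  ⟨le_max_left _ _, max_le zero_le_one (by linarith [le_max_left 0 (1 - t)])⟩

theorem clampUnit_of_mem {t : ℝ} (ht : t ∈ Icc (0 : ℝ) 1) : clampUnit t = t := by
  rw [clampUnit, max_eq_right (by linarith [ht.2] : 0 ≤ 1 - t), sub_sub_cancel, max_eq_right ht.1]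

theorem abs_clampUnit_sub_clampUnit_le (a b : ℝ) : |clampUnit a - clampUnit b| ≤ |a - b| := by
  refine (abs_max_zero_sub_max_zero_le _ _).trans ?_
  rw [sub_sub_sub_cancel_left, abs_sub_comm]
  refine (abs_max_zero_sub_max_zero_le _ _).trans ?_
  rw [sub_sub_sub_cancel_left, abs_sub_comm]

/-- Approximate multiplication on `[0,1]`: the polarization
`ab = (a + b)/2 + (a - a²)/2 + (b - b²)/2 - 2(m - m²)`, `m = (a + b)/2`, with `sqGap` in place of
`t - t²`, clamped to `[0,1]`. -/
def mulApprox (k : ℕ) (a b : ℝ) : ℝ :=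
  clampUnit ((a + b) / 2 + (sqGap k a / 2 + sqGap k b / 2 - 2 * sqGap k ((a + b) / 2)))

theorem mulApprox_mem (k : ℕ) (a b : ℝ) : mulApprox k a b ∈ Icc (0 : ℝ) 1 := clampUnit_mem _

theorem abs_mulApprox_sub_mul_le {a b : ℝ} (ha : a ∈ Icc (0 : ℝ) 1) (hb : b ∈ Icc (0 : ℝ) 1)
    (k : ℕ) : |mulApprox k a b - a * b| ≤ 1 / 4 ^ k := by
  have hab : a * b ∈ Icc (0 : ℝ) 1 := ⟨mul_nonneg ha.1 hb.1, mul_le_one₀ ha.2 hb.1 hb.2⟩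
  have hm : (a + b) / 2 ∈ Icc (0 : ℝ) 1 :=
    ⟨by linarith [ha.1, hb.1], by linarith [ha.2, hb.2]⟩
  conv_lhs => rw [← clampUnit_of_mem hab]
  refine (abs_clampUnit_sub_clampUnit_le _ _).trans ?_
  obtain ⟨hal, hau⟩ := sub_sq_sub_sqGap_mem ha k
  obtain ⟨hbl, hbu⟩ := sub_sq_sub_sqGap_mem hb k
  obtain ⟨hml, hmu⟩ := sub_sq_sub_sqGap_mem hm k
  have hpolar : (a + b) / 2 - ((a + b) / 2) ^ 2
      = (a - a ^ 2) / 4 + (b - b ^ 2) / 4 + (a + b) / 4 - a * b / 2 := by ring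
  rw [hpolar] at hml hmu
  exact abs_le.2 ⟨by linarith, by linarith⟩

theorem abs_mulApprox_sub_mulApprox_le (k : ℕ) (a b a' b' : ℝ) :
    |mulApprox k a b - mulApprox k a' b'| ≤ 2 * |a - a'| + 2 * |b - b'| := by
  refine (abs_clampUnit_sub_clampUnit_le _ _).trans ?_
  have hmean : |(a + b) / 2 - (a' + b') / 2| ≤ (|a - a'| + |b - b'|) / 2 := by
    calc |(a + b) / 2 - (a' + b') / 2| = |(a - a') + (b - b')| / 2 := by
          rw [← abs_two, ← abs_div, abs_two]; ring_nf
      _ ≤ (|a - a'| + |b - b'|) / 2 := by gcongr; exact abs_add_le _ _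
  obtain ⟨hal, hau⟩ := abs_le.1 (abs_sqGap_sub_sqGap_le k a a')
  obtain ⟨hbl, hbu⟩ := abs_le.1 (abs_sqGap_sub_sqGap_le k b b')
  obtain ⟨hml, hmu⟩ := abs_le.1
    ((abs_sqGap_sub_sqGap_le k ((a + b) / 2) ((a' + b') / 2)).trans hmean)
  obtain ⟨hal', hau'⟩ := abs_le.1 (le_refl |a - a'|)
  obtain ⟨hbl', hbu'⟩ := abs_le.1 (le_refl |b - b'|)
  exact abs_le.2 ⟨by linarith, by linarith⟩

/-- The approximate product of `p` and the factors `u l`, `l ∈ ls`. -/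
def prodApprox {L : Type*} (k : ℕ) (u : L → ℝ) (ls : List L) (p : ℝ) : ℝ :=
  ls.foldl (fun p l => mulApprox k p (u l)) p

section ProdApprox

variable {L : Type*} (k : ℕ)

@[simp]
theorem prodApprox_nil (u : L → ℝ) (p : ℝ) : prodApprox k u [] p = p := rfl

@[simp]
theorem prodApprox_cons (u : L → ℝ) (l : L) (ls : List L) (p : ℝ) :
    prodApprox k u (l :: ls) p = prodApprox k u ls (mulApprox k p (u l)) := rfl

theorem abs_prodApprox_sub_le {u : L → ℝ} (hu : ∀ l, u l ∈ Icc (0 : ℝ) 1) (ls : List L)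
    {p : ℝ} (hp : p ∈ Icc (0 : ℝ) 1) (q : ℝ) :
    |prodApprox k u ls p - q * (ls.map u).prod| ≤ |p - q| + ls.length * (1 / 4 ^ k) := by
  induction ls generalizing p q with
  | nil => simp
  | cons l ls ih =>
    have hstep : |mulApprox k p (u l) - q * u l| ≤ 1 / 4 ^ k + |p - q| := by
      calc |mulApprox k p (u l) - q * u l|
          = |(mulApprox k p (u l) - p * u l) + (p - q) * u l| := by ring_nf
        _ ≤ |mulApprox k p (u l) - p * u l| + |p - q| * |u l| := by
            rw [← abs_mul]; exact abs_add_le _ _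
        _ ≤ 1 / 4 ^ k + |p - q| := by
            refine add_le_add (abs_mulApprox_sub_mul_le hp (hu l) k) ?_
            rw [abs_of_nonneg (hu l).1]
            exact mul_le_of_le_one_right (abs_nonneg _) (hu l).2
    rw [prodApprox_cons, List.map_cons, List.prod_cons, List.length_cons, ← mul_assoc]
    refine (ih (mulApprox_mem k p (u l)) (q * u l)).trans ?_
    push_cast
    linarith

theorem abs_prodApprox_sub_prodApprox_le {u v : L → ℝ} {δ : ℝ} (hδ : 0 ≤ δ)
    (huv : ∀ l, |u l - v l| ≤ δ) (ls : List L) (p q : ℝ) :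
    |prodApprox k u ls p - prodApprox k v ls q| ≤ 4 ^ ls.length * (|p - q| + δ) := by
  induction ls generalizing p q with
  | nil => simpa using hδ
  | cons l ls ih =>
    have hstep := abs_mulApprox_sub_mulApprox_le k p (u l) q (v l)
    rw [prodApprox_cons, prodApprox_cons, List.length_cons, pow_succ, mul_assoc]
    refine (ih _ _).trans ?_
    gcongr
    linarith [huv l, abs_nonneg (p - q)]

end ProdApprox

/-! ### A register program for products of hat functions -/

/-- The registers of the program that multiplies `m` numbers: the factors, scratch space for their
computation, the running product, and for each of the three terms `sqGap k x` of `mulApprox` the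
pair that `sawtoothStep` updates together with the intermediate value `(x - 1/2)₊`. -/
inductive Reg (m : ℕ) : Type
  | fac (l : Fin m)
  | aux (l : Fin m)
  | prod
  | arg (c : Fin 3)
  | half (c : Fin 3)
  | acc (c : Fin 3)

namespace Reg

variable {m : ℕ}

/-- An injection of the registers into a finite type. -/
def encode : Reg m → (Fin m ⊕ Fin m ⊕ Unit) ⊕ (Fin 3 × Fin 3)
  | fac l => .inl (.inl l)
  | aux l => .inl (.inr (.inl l))
  | prod => .inl (.inr (.inr ()))
  | arg c => .inr (0, c)
  | half c => .inr (1, c)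
  | acc c => .inr (2, c)

theorem encode_injective : Function.Injective (encode (m := m)) := by
  rintro (_ | _ | _ | _ | _ | _) (_ | _ | _ | _ | _ | _) h <;> simp_all [encode]

instance : Fintype (Reg m) := .ofInjective encode encode_injective

/-- The layer that loads the arguments of `sqGap` in `mulApprox k (prod) (fac l)`. -/
def load (l : Fin m) : AffineLayer (Reg m) (Reg m)
  | fac i => .proj (fac i)
  | prod => .proj prod
  | arg 0 => .proj prod
  | arg 1 => .proj (fac l)
  | arg 2 => (1 / 2 : ℝ) • (.proj prod + .proj (fac l))
  | _ => 0

/-- The first layer of a step of the sawtooth recursion. -/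
def fold : AffineLayer (Reg m) (Reg m)
  | half c => .proj (arg c) - .const ℝ _ (1 / 2)
  | j => .proj j

/-- The second layer of a step of the sawtooth recursion. -/
def accumulate : AffineLayer (Reg m) (Reg m)
  | arg c => (2 : ℝ) • .proj (arg c) - (4 : ℝ) • .proj (half c)
  | acc c => (4 : ℝ) • .proj (acc c) + ((2 : ℝ) • .proj (arg c) - (4 : ℝ) • .proj (half c))
  | j => .proj j

/-- The layer that computes `(1 - t)₊`, where `clampUnit t = mulApprox k (prod) (fac l)`. -/
def readOff (k : ℕ) (l : Fin m) : AffineLayer (Reg m) (Reg m)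
  | prod => .const ℝ _ 1 - ((1 / 2 : ℝ) • (.proj prod + .proj (fac l)) +
      ((1 / 4 ^ k / 2 : ℝ) • .proj (acc 0) + (1 / 4 ^ k / 2 : ℝ) • .proj (acc 1)
        - (2 / 4 ^ k : ℝ) • .proj (acc 2)))
  | j => .proj j

/-- The layer that completes the clamping of the product. -/
def clamp : AffineLayer (Reg m) (Reg m)
  | prod => .const ℝ _ 1 - .proj prod
  | j => .proj j

/-- The program of a single step of the sawtooth recursion. -/
def sawtoothProgram : ReLUProgram (Reg m) := [fold, accumulate]

theorem run_sawtoothProgram_iterate {x : Reg m → ℝ} (hx : ∀ j, 0 ≤ x j)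
    (hacc : ∀ c, x (acc c) = 0) (k : ℕ) :
    (∀ j, 0 ≤ sawtoothProgram.run^[k] x j) ∧
      (∀ l, sawtoothProgram.run^[k] x (fac l) = x (fac l)) ∧
      sawtoothProgram.run^[k] x prod = x prod ∧
      ∀ c, (sawtoothProgram.run^[k] x (arg c), sawtoothProgram.run^[k] x (acc c))
        = sawtoothStep^[k] (x (arg c), 0) := by
  induction k with
  | zero => simp [hacc, hx]
  | succ k ih =>
    simp only [Function.iterate_succ_apply']
    set y := sawtoothProgram.run^[k] x
    obtain ⟨hy, hfac, hprod, hpair⟩ := ih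
    refine ⟨fun j => le_max_left _ _, fun l => ?_, ?_, fun c => ?_⟩
    · rw [← hfac]
      simp [sawtoothProgram, AffineLayer.relu_apply, accumulate, fold, hy]
    · rw [← hprod]
      simp [sawtoothProgram, AffineLayer.relu_apply, accumulate, fold, hy]
    · rw [← hpair c]
      simp [sawtoothProgram, AffineLayer.relu_apply, accumulate, fold, sawtoothStep, tent, hy]

end Reg

theorem ReLUProgram.run_flatten_replicate {J : Type*} (P : ReLUProgram J) (k : ℕ) (x : J → ℝ) :
    run (List.replicate k P).flatten x = P.run^[k] x := by
  induction k generalizing x with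
  | zero => rfl
  | succ k ih =>
    rw [List.replicate_succ, List.flatten_cons, run_append, ih, Function.iterate_succ_apply]

namespace Reg

variable {m : ℕ}

/-- The program that replaces the running product `p` by `mulApprox k p (fac l)`. -/
def mulProgram (k : ℕ) (l : Fin m) : ReLUProgram (Reg m) :=
  load l :: ((List.replicate k sawtoothProgram).flatten ++ [readOff k l, clamp])

theorem length_mulProgram (k : ℕ) (l : Fin m) : (mulProgram k l).length = 2 * k + 3 := by
  simp [mulProgram, sawtoothProgram, mul_comm]

theorem run_mulProgram (k : ℕ) (l : Fin m) {x : Reg m → ℝ} (hfac : ∀ i, 0 ≤ x (fac i))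
    (hprod : 0 ≤ x prod) :
    (∀ i, (mulProgram k l).run x (fac i) = x (fac i)) ∧
      (mulProgram k l).run x prod = mulApprox k (x prod) (x (fac l)) := by
  have hload : ∀ i, (load l).relu x (fac i) = x (fac i) := fun i => max_eq_right (hfac i)
  have hloadprod : (load l).relu x prod = x prod := max_eq_right hprod
  have hfst : (load l).relu x (arg 0) = x prod := max_eq_right hprod
  have hsnd : (load l).relu x (arg 1) = x (fac l) := max_eq_right (hfac l)
  have hmean : (load l).relu x (arg 2) = (x prod + x (fac l)) / 2 := by
    have hnonneg : 0 ≤ x prod + x (fac l) := add_nonneg hprod (hfac l)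
    have hvalue : load l (arg 2) x = (x prod + x (fac l)) / 2 := by
      simp [load, ← mul_add, div_eq_inv_mul]
    rw [AffineLayer.relu_apply, hvalue, max_eq_right (by positivity)]
  obtain ⟨hnonneg, hyfac, hyprod, hpair⟩ := run_sawtoothProgram_iterate
    (x := (load l).relu x) (fun j => le_max_left _ _)
    (fun c => by simp [AffineLayer.relu_apply, load]) k
  have hacc : ∀ c, sawtoothProgram.run^[k] ((load l).relu x) (acc c)
      = 4 ^ k * sqGap k ((load l).relu x (arg c)) := fun c => by
    rw [sqGap, ← hpair c, mul_div_cancel₀ _ (by positivity)]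
  simp only [hload, hloadprod] at hyfac hyprod
  simp only [mulProgram, ReLUProgram.run_cons, ReLUProgram.run_append,
    ReLUProgram.run_flatten_replicate, ReLUProgram.run_nil]
  generalize sawtoothProgram.run^[k] ((load l).relu x) = y at *
  constructor
  · intro i
    simp [AffineLayer.relu_apply, clamp, readOff, hyfac, hfac]
  · have hraw : readOff k l prod y = 1 - ((x prod + x (fac l)) / 2 + (sqGap k (x prod) / 2
        + sqGap k (x (fac l)) / 2 - 2 * sqGap k ((x prod + x (fac l)) / 2))) := by
      simp only [readOff, smul_add, AffineMap.coe_sub, AffineMap.coe_const, Function.const_one,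
        AffineMap.coe_add, AffineMap.coe_smul, Pi.sub_apply, Pi.one_apply, Pi.add_apply,
        Pi.smul_apply, AffineMap.proj_apply, smul_eq_mul, hyprod, hyfac, hacc, hfst, hsnd, hmean]
      field_simp
    simp [AffineLayer.relu_apply, clamp, hraw, mulApprox, clampUnit]

/-- The program that computes `prodApprox k fac ls prod`. -/
def prodProgram (k : ℕ) (ls : List (Fin m)) : ReLUProgram (Reg m) := ls.flatMap (mulProgram k)

theorem length_prodProgram (k : ℕ) (ls : List (Fin m)) :
    (prodProgram k ls).length = ls.length * (2 * k + 3) := by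
  simp [prodProgram, List.length_flatMap, length_mulProgram]

theorem run_prodProgram (k : ℕ) (ls : List (Fin m)) {x : Reg m → ℝ} (hfac : ∀ i, 0 ≤ x (fac i))
    (hprod : 0 ≤ x prod) :
    (prodProgram k ls).run x prod = prodApprox k (fun l => x (fac l)) ls (x prod) := by
  induction ls generalizing x with
  | nil => rfl
  | cons l ls ih =>
    obtain ⟨hxfac, hxprod⟩ := run_mulProgram k l hfac hprod
    rw [prodProgram, List.flatMap_cons, ReLUProgram.run_append, ← prodProgram,
      ih (fun i => by rw [hxfac]; exact hfac i) (by rw [hxprod]; exact (mulApprox_mem k _ _).1)]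
    simp only [hxfac, hxprod, prodApprox_cons]

end Reg

/-- The hat function. -/
def hat (t : ℝ) : ℝ := max 0 (1 - |t|)

namespace Reg

variable {m : ℕ}

/-- The layer that computes `fac l = hat t` from `fac l = t₊` and `aux l = (-t)₊`. -/
def hats : AffineLayer (Reg m) (Reg m)
  | fac l => .const ℝ _ 1 - (.proj (fac l) + .proj (aux l))
  | j => .proj j

/-- The input layer: `fac l = (p l * x (i l) - q l)₊`, `aux l = (q l - p l * x (i l))₊` and
`prod = 1`. -/
def input {d : ℕ} (i : Fin m → Fin d) (p q : Fin m → ℝ) : AffineLayer (Fin d) (Reg m)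
  | fac l => p l • .proj (i l) - .const ℝ _ (q l)
  | aux l => .const ℝ _ (q l) - p l • .proj (i l)
  | prod => .const ℝ _ 1
  | _ => 0

theorem relu_hats_relu_input {d : ℕ} (i : Fin m → Fin d) (p q : Fin m → ℝ) (x : Fin d → ℝ) :
    (∀ l, (hats.relu ((input i p q).relu x)) (fac l) = hat (p l * x (i l) - q l)) ∧
      hats.relu ((input i p q).relu x) prod = 1 := by
  refine ⟨fun l => ?_, by simp [hats, input, AffineLayer.relu_apply]⟩
  have habs : ∀ t : ℝ, max 0 t + max 0 (-t) = |t| := fun t => by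
    rw [max_comm 0, max_comm 0, ← posPart_def, ← negPart_def, posPart_add_negPart]
  simp [hats, input, AffineLayer.relu_apply, hat, ← habs]

end Reg

theorem realizable_sum_prodApprox {A : Type*} [Fintype A] {d D m : ℕ} (k : ℕ)
    (i : A → Fin m → Fin d) (p q : A → Fin m → ℝ) (c : Fin D → A → ℝ) :
    Realizable (fun (x : Fin d → ℝ) (j : Fin D) => ∑ a, c j a *
      prodApprox k (fun l => hat (p a l * x (i a l) - q a l)) (List.finRange m) 1)
      (m * (2 * k + 3) + 3)
      ((D * (Fintype.card A * Fintype.card (Reg m)) + D)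
        + (m * (2 * k + 3) + 1)
          * (Fintype.card A * Fintype.card (Reg m) * (Fintype.card (Reg m) + 2))
        + Fintype.card A * Fintype.card (Reg m) * (d + 2)) := by
  let output : AffineLayer (A × Reg m) (Fin D) := fun j =>
    LinearMap.toAffineMap (∑ a, c j a • LinearMap.proj (a, Reg.prod))
  let inputs : AffineLayer (Fin d) (A × Reg m) := fun b => Reg.input (i b.1) (p b.1) (q b.1) b.2
  have hnet := ((Realizable.affine output).comp_runBlocks
    (Reg.hats :: Reg.prodProgram k (List.finRange m))).comp_relu inputs (r := d)
    fun b => (Set.ncard_le_card _).trans (by simp)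
  rw [List.length_cons, Reg.length_prodProgram, List.length_finRange, Fintype.card_prod] at hnet
  convert hnet using 1
  · funext x j
    have houtput : ∀ y, output j y = ∑ a, c j a * y (a, .prod) := fun y => by
      simp [output, LinearMap.sum_apply]
    simp only [houtput, ReLUProgram.runBlocks, ReLUProgram.run_cons]
    refine Finset.sum_congr rfl fun a _ => ?_
    obtain ⟨hfac, hprod⟩ := Reg.relu_hats_relu_input (i a) (p a) (q a) x
    have hrun := Reg.run_prodProgram k (List.finRange m)
      (x := Reg.hats.relu ((Reg.input (i a) (p a) (q a)).relu x))
      (fun _ => le_max_left _ _) (le_max_left _ _)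
    simp only [hfac, hprod] at hrun
    rw [← hrun]
    rfl
  · ring

/-! ### Taylor expansion in iterated partial derivatives -/

section Taylor

variable {d : ℕ} {B : ℝ} {Q : Set (EuclideanSpace ℝ (Fin d))} {g : EuclideanSpace ℝ (Fin d) → ℝ}
  {x y z : EuclideanSpace ℝ (Fin d)}

theorem contDiff_partialDeriv (hg : ContDiff ℝ ∞ g) (i : Fin d) :
    ContDiff ℝ ∞ (partialDeriv i g) :=
  (hg.fderiv_right (m := ∞) (by simp)).clm_apply contDiff_const

theorem partialDeriv_comm (hg : ContDiff ℝ 2 g) (i j : Fin d) :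
    partialDeriv i (partialDeriv j g) = partialDeriv j (partialDeriv i g) := by
  have hdiff : Differentiable ℝ (fderiv ℝ g) :=
    (hg.fderiv_right (m := 1) (by norm_num)).differentiable (by simp)
  funext x
  have hsecond : ∀ a b : Fin d, partialDeriv a (partialDeriv b g) x
      = fderiv ℝ (fderiv ℝ g) x (EuclideanSpace.single a 1) (EuclideanSpace.single b 1) := by
    intro a b
    unfold partialDeriv
    rw [fderiv_clm_apply (hdiff x) (differentiableAt_const _)]
    simp
  rw [hsecond, hsecond]
  exact hg.contDiffAt.isSymmSndFDerivAt (by simp) _ _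

theorem fderiv_apply_eq_sum_partialDeriv (g : EuclideanSpace ℝ (Fin d) → ℝ)
    (x v : EuclideanSpace ℝ (Fin d)) : fderiv ℝ g x v = ∑ i, v i * partialDeriv i g x := by
  have hv : ∑ i, v i • EuclideanSpace.single i (1 : ℝ) = v := by
    ext j
    simp [Pi.single_apply]
  conv_lhs => rw [← hv]
  simp only [map_sum, map_smul, smul_eq_mul]
  rfl

theorem hasDerivAt_comp_line {v : EuclideanSpace ℝ (Fin d)} {τ : ℝ}
    (hg : DifferentiableAt ℝ g (x + τ • v)) :
    HasDerivAt (fun τ : ℝ => g (x + τ • v)) (∑ i, v i * partialDeriv i g (x + τ • v)) τ := by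
  have hline : HasDerivAt (fun τ : ℝ => x + τ • v) v τ := by
    simpa using ((hasDerivAt_id τ).smul_const v).const_add x
  rw [← fderiv_apply_eq_sum_partialDeriv]
  exact hg.hasFDerivAt.comp_hasDerivAt τ hline

/-- The iterated partial derivative along a word, the head of the word being applied first. -/
def wordDeriv : List (Fin d) → (EuclideanSpace ℝ (Fin d) → ℝ) → EuclideanSpace ℝ (Fin d) → ℝ
  | [], g => g
  | i :: w, g => wordDeriv w (partialDeriv i g)

/-- All iterated partial derivatives of `g` up to order `n` are bounded by `B` on `Q`. -/
def DerivBound (n : ℕ) (B : ℝ) (Q : Set (EuclideanSpace ℝ (Fin d)))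
    (g : EuclideanSpace ℝ (Fin d) → ℝ) : Prop :=
  ∀ w : List (Fin d), w.length ≤ n → ∀ x ∈ Q, |wordDeriv w g x| ≤ B

namespace DerivBound

theorem mono {k n : ℕ} (h : DerivBound n B Q g) (hkn : k ≤ n) : DerivBound k B Q g :=
  fun w hw => h w (hw.trans hkn)

theorem partialDeriv {n : ℕ} (h : DerivBound (n + 1) B Q g) (i : Fin d) :
    DerivBound n B Q (partialDeriv i g) :=
  fun w hw => h (i :: w) (Nat.succ_le_succ hw)

theorem abs_le {n : ℕ} (h : DerivBound n B Q g) (hx : x ∈ Q) : |g x| ≤ B :=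
  h [] (Nat.zero_le n) x hx

end DerivBound

/-- The `k`-th iterated derivative of `g` at `z` in the direction `h`. -/
def taylorTerm : ℕ → (EuclideanSpace ℝ (Fin d) → ℝ) → EuclideanSpace ℝ (Fin d) →
    EuclideanSpace ℝ (Fin d) → ℝ
  | 0, g, z, _ => g z
  | k + 1, g, z, h => ∑ i, h i * taylorTerm k (partialDeriv i g) z h

theorem hasDerivAt_taylorTerm (k : ℕ) (hg : ContDiff ℝ ∞ g) (z h v : EuclideanSpace ℝ (Fin d))
    (τ : ℝ) :
    HasDerivAt (fun τ : ℝ => taylorTerm (k + 1) g z (h + τ • v))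
      ((k + 1) * ∑ i, v i * taylorTerm k (partialDeriv i g) z (h + τ • v)) τ := by
  have hline : ∀ i, HasDerivAt (fun τ : ℝ => (h + τ • v) i) (v i) τ := fun i => by
    simpa using ((hasDerivAt_id τ).mul_const (v i)).const_add (h i)
  induction k generalizing g with
  | zero =>
    simpa [taylorTerm] using HasDerivAt.fun_sum fun i (_ : i ∈ Finset.univ) =>
      (hline i).mul_const (partialDeriv i g z)
  | succ k ih =>
    have hterms := HasDerivAt.fun_sum fun i (_ : i ∈ Finset.univ) =>
      (hline i).fun_mul (ih (contDiff_partialDeriv hg i))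
    refine HasDerivAt.congr_deriv (f := fun τ : ℝ => taylorTerm (k + 1 + 1) g z (h + τ • v))
      hterms ?_
    have hswap : ∑ i, (h + τ • v) i * ((k + 1) * ∑ j, v j *
        taylorTerm k (partialDeriv j (partialDeriv i g)) z (h + τ • v))
        = (k + 1) * ∑ i, v i * taylorTerm (k + 1) (partialDeriv i g) z (h + τ • v) := by
      simp only [taylorTerm, Finset.mul_sum]
      rw [Finset.sum_comm]
      refine Finset.sum_congr rfl fun i _ => Finset.sum_congr rfl fun j _ => ?_
      rw [partialDeriv_comm (contDiff_infty.1 hg 2) i j]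
      ring
    rw [Finset.sum_add_distrib, hswap]
    push_cast
    ring

/-- The Taylor polynomial of degree less than `n` of `g` at `z`. -/
def taylorPoly (n : ℕ) (g : EuclideanSpace ℝ (Fin d) → ℝ) (z x : EuclideanSpace ℝ (Fin d)) : ℝ :=
  ∑ k ∈ Finset.range n, 1 / (k.factorial : ℝ) * taylorTerm k g z (x - z)

theorem taylorPoly_succ_self (n : ℕ) (g : EuclideanSpace ℝ (Fin d) → ℝ)
    (z : EuclideanSpace ℝ (Fin d)) : taylorPoly (n + 1) g z z = g z := by
  rw [taylorPoly, Finset.sum_range_succ']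
  simp [taylorTerm]

theorem hasDerivAt_taylorPoly (n : ℕ) (hg : ContDiff ℝ ∞ g) (z x v : EuclideanSpace ℝ (Fin d))
    (τ : ℝ) :
    HasDerivAt (fun τ : ℝ => taylorPoly (n + 1) g z (x + τ • v))
      (∑ i, v i * taylorPoly n (partialDeriv i g) z (x + τ • v)) τ := by
  have hpoly : (fun τ : ℝ => taylorPoly (n + 1) g z (x + τ • v)) = fun τ : ℝ =>
      (∑ k ∈ Finset.range n, (1 / ((k + 1).factorial : ℝ)) *
        taylorTerm (k + 1) g z ((x - z) + τ • v)) + g z := by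
    funext τ
    rw [taylorPoly, Finset.sum_range_succ', add_sub_right_comm]
    simp [taylorTerm]
  rw [hpoly]
  have hsum := (HasDerivAt.fun_sum fun k (_ : k ∈ Finset.range n) =>
    (hasDerivAt_taylorTerm k hg z (x - z) v τ).const_mul
      (1 / ((k + 1).factorial : ℝ))).add_const (g z)
  refine hsum.congr_deriv ?_
  simp only [taylorPoly, Finset.mul_sum, add_sub_right_comm]
  rw [Finset.sum_comm]
  refine Finset.sum_congr rfl fun i _ => Finset.sum_congr rfl fun k _ => ?_
  rw [Nat.factorial_succ]
  push_cast
  field_simp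

/-- The `ℓ¹` norm of a vector. -/
def normOne (v : EuclideanSpace ℝ (Fin d)) : ℝ := ∑ i, |v i|

theorem normOne_nonneg (v : EuclideanSpace ℝ (Fin d)) : 0 ≤ normOne v :=
  Finset.sum_nonneg fun _ _ => abs_nonneg _

theorem normOne_le (v : EuclideanSpace ℝ (Fin d)) : normOne v ≤ d * ‖v‖ := by
  refine (Finset.sum_le_card_nsmul _ _ ‖v‖ fun i _ => ?_).trans (by simp)
  exact PiLp.norm_apply_le v i

theorem normOne_smul (t : ℝ) (v : EuclideanSpace ℝ (Fin d)) :
    normOne (t • v) = |t| * normOne v := by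
  simp [normOne, abs_mul, Finset.mul_sum]

theorem abs_taylorRemainder_sub_le {n : ℕ} {ρ : ℝ} (hB : 0 ≤ B) (hQ : Convex ℝ Q)
    (hg : ContDiff ℝ ∞ g) (hx : x ∈ Q) (hy : y ∈ Q)
    (hrem : ∀ i, ∀ u ∈ Q, |partialDeriv i g u - taylorPoly n (partialDeriv i g) z u|
      ≤ B * normOne (u - z) ^ n)
    (hρ : ∀ τ ∈ Icc (0 : ℝ) 1, normOne (x + τ • (y - x) - z) ≤ ρ) :
    |(g y - taylorPoly (n + 1) g z y) - (g x - taylorPoly (n + 1) g z x)|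
      ≤ normOne (y - x) * (B * ρ ^ n) := by
  have hderiv : ∀ τ : ℝ, HasDerivAt
      (fun τ : ℝ => g (x + τ • (y - x)) - taylorPoly (n + 1) g z (x + τ • (y - x)))
      (∑ i, (y - x) i * (partialDeriv i g (x + τ • (y - x))
        - taylorPoly n (partialDeriv i g) z (x + τ • (y - x)))) τ := by
    intro τ
    refine ((hasDerivAt_comp_line (hg.differentiable (by simp) _)).sub
      (hasDerivAt_taylorPoly n hg z x (y - x) τ)).congr_deriv ?_
    rw [← Finset.sum_sub_distrib]
    simp only [mul_sub]
  suffices hbound : ∀ τ ∈ Ico (0 : ℝ) 1, ‖∑ i, (y - x) i * (partialDeriv i g (x + τ • (y - x))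
      - taylorPoly n (partialDeriv i g) z (x + τ • (y - x)))‖ ≤ normOne (y - x) * (B * ρ ^ n) by
    simpa using norm_image_sub_le_of_norm_deriv_le_segment_01'
      (fun τ _ => (hderiv τ).hasDerivWithinAt) hbound
  intro τ hτ
  have hmem : x + τ • (y - x) ∈ Q := hQ.add_smul_sub_mem hx hy (Ico_subset_Icc_self hτ)
  rw [normOne, Finset.sum_mul]
  refine (norm_sum_le _ _).trans (Finset.sum_le_sum fun i _ => ?_)
  rw [Real.norm_eq_abs, abs_mul]
  refine mul_le_mul_of_nonneg_left ((hrem i _ hmem).trans ?_) (abs_nonneg _)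
  refine mul_le_mul_of_nonneg_left ?_ hB
  exact pow_le_pow_left₀ (normOne_nonneg _) (hρ τ (Ico_subset_Icc_self hτ)) n

theorem abs_taylorRemainder_le {n : ℕ} (hB : 0 ≤ B) (hQ : Convex ℝ Q) (hg : ContDiff ℝ ∞ g)
    (h : DerivBound n B Q g) (hz : z ∈ Q) (hx : x ∈ Q) :
    |g x - taylorPoly n g z x| ≤ B * normOne (x - z) ^ n := by
  induction n generalizing g x with
  | zero => simpa [taylorPoly] using h.abs_le hx
  | succ n ih =>
    have hseg : ∀ τ ∈ Icc (0 : ℝ) 1, normOne (z + τ • (x - z) - z) ≤ normOne (x - z) := by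
      intro τ hτ
      rw [add_sub_cancel_left, normOne_smul, abs_of_nonneg hτ.1]
      exact mul_le_of_le_one_left (normOne_nonneg _) hτ.2
    have hsub := abs_taylorRemainder_sub_le hB hQ hg hz hx
      (fun i u hu => ih (contDiff_partialDeriv hg i) (h.partialDeriv i) hu) hseg
    rw [taylorPoly_succ_self, sub_self, sub_zero] at hsub
    rw [pow_succ]
    linarith

end Taylor

/-! ### Polynomials with bounded coefficients -/

section BddPoly

variable {d : ℕ}

/-- The coordinates of `x`, together with the constant `1`. -/
def coordOrOne (x : EuclideanSpace ℝ (Fin d)) : Option (Fin d) → ℝ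
  | none => 1
  | some i => x i

/-- `p` is a polynomial of degree at most `k` with coefficients bounded by `A`, written as a
combination of `k`-fold products of the coordinates and `1`. -/
def IsBddPoly (k : ℕ) (A : ℝ) (p : EuclideanSpace ℝ (Fin d) → ℝ) : Prop :=
  ∃ c : (Fin k → Option (Fin d)) → ℝ, (∀ r, |c r| ≤ A) ∧
    ∀ x, p x = ∑ r, c r * ∏ j, coordOrOne x (r j)

theorem sum_option_cons (k : ℕ) (x : EuclideanSpace ℝ (Fin d))
    (c : Option (Fin d) → (Fin k → Option (Fin d)) → ℝ) :
    ∑ r : Fin (k + 1) → Option (Fin d), c (r 0) (Fin.tail r) * ∏ j, coordOrOne x (r j)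
      = ∑ r, c none r * ∏ j, coordOrOne x (r j)
        + ∑ i, x i * ∑ r, c (some i) r * ∏ j, coordOrOne x (r j) := by
  rw [← (Fin.consEquiv fun _ : Fin (k + 1) => Option (Fin d)).sum_comp, Fintype.sum_prod_type,
    Fintype.sum_option]
  have hcons : ∀ (o : Option (Fin d)) (r : Fin k → Option (Fin d)),
      (Fin.consEquiv fun _ : Fin (k + 1) => Option (Fin d)) (o, r) = Fin.cons o r :=
    fun _ _ => rfl
  simp only [hcons, Fin.cons_zero, Fin.tail_cons, Fin.prod_univ_succ, Fin.cons_succ,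
    Finset.mul_sum]
  congr 1
  · simp [coordOrOne]
  · simp [coordOrOne, mul_left_comm]

namespace IsBddPoly

variable {k : ℕ} {A A' : ℝ} {p p' : EuclideanSpace ℝ (Fin d) → ℝ}

theorem mono (h : IsBddPoly k A p) (hA : A ≤ A') : IsBddPoly k A' p := by
  obtain ⟨c, hc, hp⟩ := h
  exact ⟨c, fun r => (hc r).trans hA, hp⟩

theorem succ (hA : 0 ≤ A) (h : IsBddPoly k A p) : IsBddPoly (k + 1) A p := by
  obtain ⟨c, hc, hp⟩ := h
  let c' : Option (Fin d) → (Fin k → Option (Fin d)) → ℝ := fun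
    | none => c
    | some _ => 0
  refine ⟨fun r => c' (r 0) (Fin.tail r), fun r => ?_, fun x => ?_⟩
  · change |c' (r 0) (Fin.tail r)| ≤ A
    rcases r 0 with _ | i
    · exact hc _
    · simpa [c'] using hA
  · rw [sum_option_cons, hp]
    simp [c']

theorem add (h : IsBddPoly k A p) (h' : IsBddPoly k A' p') :
    IsBddPoly k (A + A') (fun x => p x + p' x) := by
  obtain ⟨c, hc, hp⟩ := h
  obtain ⟨c', hc', hp'⟩ := h'
  refine ⟨c + c', fun r => (abs_add_le _ _).trans (add_le_add (hc r) (hc' r)), fun x => ?_⟩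
  simp [hp, hp', add_mul, Finset.sum_add_distrib]

theorem const_mul (h : IsBddPoly k A p) (t : ℝ) : IsBddPoly k (|t| * A) (fun x => t * p x) := by
  obtain ⟨c, hc, hp⟩ := h
  refine ⟨fun r => t * c r, fun r => ?_, fun x => ?_⟩
  · rw [abs_mul]
    exact mul_le_mul_of_nonneg_left (hc r) (abs_nonneg _)
  · simp [hp, Finset.mul_sum, mul_assoc]

theorem sum_sub_mul (hA : 0 ≤ A) {z : EuclideanSpace ℝ (Fin d)} (hz : ∀ i, z i ∈ Icc (0 : ℝ) 1)
    {p : Fin d → EuclideanSpace ℝ (Fin d) → ℝ} (h : ∀ i, IsBddPoly k A (p i)) :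
    IsBddPoly (k + 1) (d * A) (fun x => ∑ i, (x - z) i * p i x) := by
  choose c hc hp using h
  let c' : Option (Fin d) → (Fin k → Option (Fin d)) → ℝ := fun
    | none => fun r => -∑ i, z i * c i r
    | some i => c i
  refine ⟨fun r => c' (r 0) (Fin.tail r), fun r => ?_, fun x => ?_⟩
  · change |c' (r 0) (Fin.tail r)| ≤ d * A
    rcases r 0 with _ | i
    · simp only [c', abs_neg]
      refine (Finset.abs_sum_le_sum_abs _ _).trans ?_
      refine (Finset.sum_le_card_nsmul _ _ A fun i _ => ?_).trans (by simp)
      rw [abs_mul, abs_of_nonneg (hz i).1]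
      exact (mul_le_of_le_one_left (abs_nonneg _) (hz i).2).trans (hc i _)
    · have hd : (1 : ℝ) ≤ d := by exact_mod_cast i.pos
      exact (hc i _).trans (le_mul_of_one_le_left hA hd)
  · rw [sum_option_cons]
    simp only [c', neg_mul, Finset.sum_mul, Finset.sum_neg_distrib, ← hp]
    rw [Finset.sum_comm]
    simp only [mul_assoc, ← Finset.mul_sum, ← hp]
    simp only [PiLp.sub_apply, sub_mul, Finset.sum_sub_distrib]
    ring

end IsBddPoly

variable {B : ℝ} {Q : Set (EuclideanSpace ℝ (Fin d))} {g : EuclideanSpace ℝ (Fin d) → ℝ}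
  {z : EuclideanSpace ℝ (Fin d)}

theorem isBddPoly_taylorTerm (k : ℕ) (hB : 0 ≤ B) (h : DerivBound k B Q g) (hzQ : z ∈ Q)
    (hz : ∀ i, z i ∈ Icc (0 : ℝ) 1) :
    IsBddPoly k (d ^ k * B) (fun x => taylorTerm k g z (x - z)) := by
  induction k generalizing g with
  | zero =>
    exact ⟨fun _ => g z, fun _ => by simpa using h.abs_le hzQ, fun x => by simp [taylorTerm]⟩
  | succ k ih =>
    rw [pow_succ', mul_assoc]
    exact .sum_sub_mul (by positivity) hz fun i => ih (h.partialDeriv i)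

theorem isBddPoly_taylorPoly (n : ℕ) (hB : 0 ≤ B) (h : DerivBound n B Q g) (hzQ : z ∈ Q)
    (hz : ∀ i, z i ∈ Icc (0 : ℝ) 1) :
    IsBddPoly n (n * (d + 1) ^ n * B) (taylorPoly n g z) := by
  induction n with
  | zero => exact ⟨0, by simp, fun x => by simp [taylorPoly]⟩
  | succ n ih =>
    have hterm := ((isBddPoly_taylorTerm n hB (h.mono n.le_succ) hzQ hz).succ
      (by positivity)).const_mul (1 / (n.factorial : ℝ))
    have hpoly : taylorPoly (n + 1) g z = fun x => taylorPoly n g z x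
        + 1 / (n.factorial : ℝ) * taylorTerm n g z (x - z) := by
      funext x
      rw [taylorPoly, Finset.sum_range_succ, ← taylorPoly]
    have hfactorial : |1 / (n.factorial : ℝ)| ≤ 1 := by
      rw [abs_of_nonneg (by positivity)]
      exact div_le_one_of_le₀ (by exact_mod_cast n.factorial_pos) (by positivity)
    have hpow : (d + 1 : ℝ) ^ n ≤ (d + 1) ^ (n + 1) := pow_le_pow_right₀ (by simp) n.le_succ
    rw [hpoly]
    refine (((ih (h.mono n.le_succ)).succ (by positivity)).add hterm).mono ?_
    calc n * (d + 1) ^ n * B + |1 / (n.factorial : ℝ)| * (d ^ n * B)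
        ≤ n * (d + 1) ^ (n + 1) * B + 1 * ((d + 1) ^ (n + 1) * B) := by
          gcongr
          exact (pow_le_pow_left₀ (by positivity) (by simp) n).trans hpow
      _ = (n + 1 : ℕ) * (d + 1) ^ (n + 1) * B := by push_cast; ring

end BddPoly

/-! ### A partition of unity of hat functions -/

section PartitionOfUnity

theorem hat_mem (t : ℝ) : hat t ∈ Icc (0 : ℝ) 1 :=
  ⟨le_max_left _ _, max_le zero_le_one (by linarith [abs_nonneg t])⟩

theorem abs_hat_sub_hat_le (t u : ℝ) : |hat t - hat u| ≤ |t - u| := by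
  refine (abs_max_zero_sub_max_zero_le _ _).trans ?_
  rw [sub_sub_sub_cancel_left, abs_sub_comm t u]
  exact abs_abs_sub_abs_le_abs_sub _ _

theorem abs_lt_one_of_hat_ne_zero {t : ℝ} (h : hat t ≠ 0) : |t| < 1 := by
  by_contra hc
  exact h (max_eq_left (by linarith))

theorem hat_eq_sub (t : ℝ) :
    hat t = (max 0 (t + 1) - max 0 t) - (max 0 t - max 0 (t - 1)) := by
  grind [hat]

theorem sum_hat_eq_one {N : ℕ} {t : ℝ} (ht : t ∈ Icc (0 : ℝ) N) :
    ∑ m : Fin (N + 1), hat (t - m) = 1 := by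
  let slope : ℕ → ℝ := fun m => max 0 (t - m + 1) - max 0 (t - m)
  have hhat : ∀ m : ℕ, hat (t - m) = slope m - slope (m + 1) := fun m => by
    simp only [slope, hat_eq_sub (t - m)]
    push_cast
    ring_nf
  have hfirst : slope 0 = 1 := by
    simp only [slope, Nat.cast_zero, sub_zero]
    rw [max_eq_right (by linarith [ht.1]), max_eq_right ht.1, add_sub_cancel_left]
  have hlast : slope (N + 1) = 0 := by
    simp only [slope, Nat.cast_add, Nat.cast_one]
    rw [max_eq_left (by linarith [ht.2]), max_eq_left (by linarith [ht.2]), sub_self]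
  rw [Fin.sum_univ_eq_sum_range fun m => hat (t - m), Finset.sum_congr rfl fun m _ => hhat m,
    Finset.sum_range_sub', hfirst, hlast, sub_zero]

theorem abs_prod_sub_prod_le {ι : Type*} (t : Finset ι) {a b : ι → ℝ}
    (ha : ∀ i, a i ∈ Icc (0 : ℝ) 1) (hb : ∀ i, b i ∈ Icc (0 : ℝ) 1) :
    |∏ i ∈ t, a i - ∏ i ∈ t, b i| ≤ ∑ i ∈ t, |a i - b i| := by
  classical
  induction t using Finset.induction_on with
  | empty => simp
  | insert j t hj ih =>
    have hprod : |∏ i ∈ t, a i| ≤ 1 := by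
      rw [Finset.abs_prod]
      exact Finset.prod_le_one (fun _ _ => abs_nonneg _) fun i _ =>
        abs_le.2 ⟨by linarith [(ha i).1], (ha i).2⟩
    have hbj : |b j| ≤ 1 := abs_le.2 ⟨by linarith [(hb j).1], (hb j).2⟩
    rw [Finset.prod_insert hj, Finset.prod_insert hj, Finset.sum_insert hj]
    calc |a j * ∏ i ∈ t, a i - b j * ∏ i ∈ t, b i|
        = |(a j - b j) * ∏ i ∈ t, a i + b j * (∏ i ∈ t, a i - ∏ i ∈ t, b i)| := by ring_nf
      _ ≤ |a j - b j| * |∏ i ∈ t, a i| + |b j| * |∏ i ∈ t, a i - ∏ i ∈ t, b i| := by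
          rw [← abs_mul, ← abs_mul]
          exact abs_add_le _ _
      _ ≤ |a j - b j| + ∑ i ∈ t, |a i - b i| :=
          add_le_add (mul_le_of_le_one_right (abs_nonneg _) hprod)
            ((mul_le_of_le_one_left (abs_nonneg _) hbj).trans ih)

variable {d N : ℕ} {m : Fin d → Fin (N + 1)} {x y : EuclideanSpace ℝ (Fin d)}

/-- The tensor product hat function at the grid point `m / N`. -/
def bump (N : ℕ) (m : Fin d → Fin (N + 1)) (x : EuclideanSpace ℝ (Fin d)) : ℝ :=
  ∏ i, hat (N * x i - m i)

theorem bump_nonneg (N : ℕ) (m : Fin d → Fin (N + 1)) (x : EuclideanSpace ℝ (Fin d)) :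
    0 ≤ bump N m x :=
  Finset.prod_nonneg fun _ _ => (hat_mem _).1

theorem sum_bump (hx : ∀ i, x i ∈ Icc (0 : ℝ) 1) : ∑ m, bump N m x = 1 := by
  have hprod := Finset.prod_univ_sum (fun _ : Fin d => (Finset.univ : Finset (Fin (N + 1))))
    (fun i m => hat (N * x i - m))
  rw [Fintype.piFinset_univ] at hprod
  unfold bump
  rw [← hprod]
  refine Finset.prod_eq_one fun i _ => sum_hat_eq_one ⟨?_, ?_⟩
  · exact mul_nonneg N.cast_nonneg (hx i).1
  · exact mul_le_of_le_one_right N.cast_nonneg (hx i).2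

theorem abs_bump_sub_bump_le (N : ℕ) (m : Fin d → Fin (N + 1)) (x y : EuclideanSpace ℝ (Fin d)) :
    |bump N m x - bump N m y| ≤ N * normOne (x - y) := by
  refine (abs_prod_sub_prod_le _ (fun _ => hat_mem _) fun _ => hat_mem _).trans ?_
  rw [normOne, Finset.mul_sum]
  refine Finset.sum_le_sum fun i _ => (abs_hat_sub_hat_le _ _).trans_eq ?_
  rw [sub_sub_sub_cancel_right, ← mul_sub, abs_mul, Nat.abs_cast]
  rfl

theorem abs_lt_one_of_bump_ne_zero (h : bump N m x ≠ 0) (i : Fin d) : |N * x i - m i| < 1 :=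
  abs_lt_one_of_hat_ne_zero (Finset.prod_ne_zero_iff.1 h i (Finset.mem_univ _))

theorem abs_sum_bump_mul_le (hx : ∀ i, x i ∈ Icc (0 : ℝ) 1) {R : (Fin d → Fin (N + 1)) → ℝ}
    {C : ℝ} (hR : ∀ m, bump N m x ≠ 0 → |R m| ≤ C) : |∑ m, bump N m x * R m| ≤ C := by
  calc |∑ m, bump N m x * R m|
      ≤ ∑ m, bump N m x * C := by
        refine (Finset.abs_sum_le_sum_abs _ _).trans (Finset.sum_le_sum fun m _ => ?_)
        rw [abs_mul, abs_of_nonneg (bump_nonneg _ _ _)]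
        rcases eq_or_ne (bump N m x) 0 with hm | hm
        · simp [hm]
        · exact mul_le_mul_of_nonneg_left (hR m hm) (bump_nonneg _ _ _)
    _ = C := by rw [← Finset.sum_mul, sum_bump hx, one_mul]

theorem card_filter_abs_sub_lt_two_le (N : ℕ) (t : ℝ) :
    (Finset.univ.filter fun m : Fin (N + 1) => |t - m| < 2).card ≤ 5 := by
  let near := Finset.univ.filter fun m : Fin (N + 1) => |t - m| < 2
  have hsub : (near.image fun m : Fin (N + 1) => ((m : ℕ) : ℤ))
      ⊆ Finset.Icc (⌊t⌋ - 2) (⌊t⌋ + 2) := by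
    intro z hz
    simp only [near, Finset.mem_image, Finset.mem_filter, Finset.mem_univ, true_and] at hz
    obtain ⟨m, hm, rfl⟩ := hz
    obtain ⟨hlower, hupper⟩ := abs_lt.1 hm
    have hfloor := Int.floor_le t
    have hfloor' := Int.lt_floor_add_one t
    have hl : ⌊t⌋ < ((m : ℕ) : ℤ) + 2 := by
      have : (⌊t⌋ : ℝ) < ((m : ℕ) : ℤ) + 2 := by push_cast; linarith
      exact_mod_cast this
    have hu : ((m : ℕ) : ℤ) < ⌊t⌋ + 3 := by
      have : (((m : ℕ) : ℤ) : ℝ) < ⌊t⌋ + 3 := by push_cast; linarith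
      exact_mod_cast this
    exact Finset.mem_Icc.2 ⟨by omega, by omega⟩
  have hinj : Function.Injective fun m : Fin (N + 1) => ((m : ℕ) : ℤ) :=
    Nat.cast_injective.comp Fin.val_injective
  calc near.card = (near.image fun m : Fin (N + 1) => ((m : ℕ) : ℤ)).card :=
        (Finset.card_image_of_injective _ hinj).symm
    _ ≤ (Finset.Icc (⌊t⌋ - 2) (⌊t⌋ + 2)).card := Finset.card_le_card hsub
    _ ≤ 5 := by rw [Int.card_Icc]; omega

theorem card_filter_forall_abs_sub_lt_two_le (N : ℕ) (x : EuclideanSpace ℝ (Fin d)) :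
    (Finset.univ.filter fun m : Fin d → Fin (N + 1) => ∀ i, |N * x i - m i| < 2).card
      ≤ 5 ^ d := by
  have hpi : (Finset.univ.filter fun m : Fin d → Fin (N + 1) => ∀ i, |N * x i - m i| < 2)
      = Fintype.piFinset fun i => Finset.univ.filter fun k : Fin (N + 1) => |N * x i - k| < 2 := by
    ext m
    simp
  rw [hpi, Fintype.card_piFinset]
  refine (Finset.prod_le_pow_card _ _ 5 fun i _ => card_filter_abs_sub_lt_two_le N _).trans ?_
  simp

theorem abs_sum_bump_sub_bump_mul_le (hxy : ∀ i, |N * x i - N * y i| ≤ 1)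
    {R : (Fin d → Fin (N + 1)) → ℝ} {C : ℝ} (hC : 0 ≤ C)
    (hR : ∀ m : Fin d → Fin (N + 1), (∀ i, |N * x i - m i| < 2) → |R m| ≤ C) :
    |∑ m, (bump N m x - bump N m y) * R m| ≤ 5 ^ d * (N * normOne (x - y) * C) := by
  let near := Finset.univ.filter fun m : Fin d → Fin (N + 1) => ∀ i, |N * x i - m i| < 2
  have hnonneg : 0 ≤ N * normOne (x - y) * C :=
    mul_nonneg (mul_nonneg N.cast_nonneg (normOne_nonneg _)) hC
  have hfar : ∀ m ∉ near, bump N m x = 0 ∧ bump N m y = 0 := by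
    intro m hm
    refine ⟨by_contra fun hx => hm ?_, by_contra fun hy => hm ?_⟩ <;>
      refine Finset.mem_filter.2 ⟨Finset.mem_univ _, fun i => ?_⟩
    · linarith [abs_lt_one_of_bump_ne_zero hx i]
    · have htri := abs_sub_le (N * x i) (N * y i) (m i)
      linarith [abs_lt_one_of_bump_ne_zero hy i, hxy i]
  calc |∑ m, (bump N m x - bump N m y) * R m|
      = |∑ m ∈ near, (bump N m x - bump N m y) * R m| := by
        rw [Finset.sum_subset near.subset_univ fun m _ hm => ?_]
        rw [(hfar m hm).1, (hfar m hm).2, sub_zero, zero_mul]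
    _ ≤ near.card • (N * normOne (x - y) * C) := by
        refine (Finset.abs_sum_le_sum_abs _ _).trans
          (Finset.sum_le_card_nsmul _ _ _ fun m hm => ?_)
        rw [abs_mul]
        exact mul_le_mul (abs_bump_sub_bump_le _ _ _ _) (hR m (Finset.mem_filter.1 hm).2)
          (abs_nonneg _) (mul_nonneg N.cast_nonneg (normOne_nonneg _))
    _ ≤ 5 ^ d * (N * normOne (x - y) * C) := by
        rw [nsmul_eq_mul]
        refine mul_le_mul_of_nonneg_right ?_ hnonneg
        exact_mod_cast card_filter_forall_abs_sub_lt_two_le N x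

end PartitionOfUnity

/-! ### Localized Taylor approximation -/

section LocalTaylor

variable {d N : ℕ} {η : ℝ} {x y : EuclideanSpace ℝ (Fin d)}

/-- The closed cube `[η, 1 - η]^d`. -/
def innerCube (d : ℕ) (η : ℝ) : Set (EuclideanSpace ℝ (Fin d)) :=
  {x | ∀ i, x i ∈ Icc η (1 - η)}

theorem convex_innerCube (η : ℝ) : Convex ℝ (innerCube d η) := by
  intro x hx y hy a b ha hb hab i
  exact convex_Icc η (1 - η) (hx i) (hy i) ha hb hab

theorem mem_Icc_of_mem_innerCube (hη : 0 ≤ η) (hx : x ∈ innerCube d η) (i : Fin d) :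
    x i ∈ Icc (0 : ℝ) 1 :=
  ⟨hη.trans (hx i).1, (hx i).2.trans (by linarith)⟩

/-- The point of `[η, 1 - η]^d` closest to the grid point `m / N`. -/
def node (N : ℕ) (η : ℝ) (m : Fin d → Fin (N + 1)) : EuclideanSpace ℝ (Fin d) :=
  WithLp.toLp 2 fun i => max η (min (1 - η) (m i / N))

theorem node_mem_innerCube (hη : η ≤ 1 / 2) (m : Fin d → Fin (N + 1)) :
    node N η m ∈ innerCube d η :=
  fun _ => ⟨le_max_left _ _, max_le (by linarith) (min_le_left _ _)⟩

theorem abs_sub_max_min_le {a b t u : ℝ} (ht : t ∈ Icc a b) :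
    |t - max a (min b u)| ≤ |t - u| := by
  have hclamp : max a (min b t) = t := by rw [min_eq_right ht.2, max_eq_right ht.1]
  calc |t - max a (min b u)| = |max a (min b t) - max a (min b u)| := by rw [hclamp]
    _ ≤ |min b t - min b u| := by
        simpa using abs_max_sub_max_le_max a (min b t) a (min b u)
    _ ≤ |t - u| := by simpa using abs_min_sub_min_le_max b t b u

theorem normOne_sub_node_le (hN : 0 < N) {ρ : ℝ} (hx : x ∈ innerCube d η)
    {m : Fin d → Fin (N + 1)} (h : ∀ i, |N * x i - m i| ≤ ρ) :
    normOne (x - node N η m) ≤ d * ρ / N := by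
  have hN' : (0 : ℝ) < N := by exact_mod_cast hN
  refine (Finset.sum_le_card_nsmul _ _ (ρ / N) fun i _ => ?_).trans (by simp [mul_div_assoc])
  calc |(x - node N η m) i| ≤ |x i - m i / N| := abs_sub_max_min_le (hx i)
    _ = |N * x i - m i| / N := by
        rw [← abs_of_pos hN', ← abs_div, abs_of_pos hN', sub_div, mul_div_cancel_left₀ _ hN'.ne']
    _ ≤ ρ / N := by gcongr; exact h i

/-- The indices of the localized monomials: a grid point, and `n` factors each of which is a
coordinate or, for `none`, the constant `1`. -/
abbrev LocalIndex (d n N : ℕ) : Type :=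
  (Fin d → Fin (N + 1)) × (Fin n → Option (Fin d))

/-- The monomial with factors `a.2`, localized at the grid point `a.1 / N`. -/
def localMonomial {n : ℕ} (N : ℕ) (a : LocalIndex d n N) (x : EuclideanSpace ℝ (Fin d)) : ℝ :=
  bump N a.1 x * ∏ j, coordOrOne x (a.2 j)

/-- The error of the approximation of `g` by its Taylor polynomials at the nodes, glued together by
the partition of unity. -/
def localError (n N : ℕ) (η : ℝ) (g : EuclideanSpace ℝ (Fin d) → ℝ)
    (x : EuclideanSpace ℝ (Fin d)) : ℝ :=
  ∑ m : Fin d → Fin (N + 1), bump N m x * (g x - taylorPoly n g (node N η m) x)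

variable {n : ℕ} {B : ℝ} {g : EuclideanSpace ℝ (Fin d) → ℝ}

theorem abs_sub_taylorPoly_node_le (hN : 0 < N) (hη : η ≤ 1 / 2) (hB : 0 ≤ B)
    (hg : ContDiff ℝ ∞ g) (h : DerivBound n B (innerCube d η) g) (hx : x ∈ innerCube d η) {ρ : ℝ}
    {m : Fin d → Fin (N + 1)} (hm : ∀ i, |N * x i - m i| ≤ ρ) :
    |g x - taylorPoly n g (node N η m) x| ≤ B * (d * ρ / N) ^ n := by
  refine (abs_taylorRemainder_le hB (convex_innerCube η) hg h (node_mem_innerCube hη m) hx).trans ?_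
  gcongr
  · exact normOne_nonneg _
  · exact normOne_sub_node_le hN hx hm

theorem abs_localError_le (hN : 0 < N) (hη0 : 0 ≤ η) (hη : η ≤ 1 / 2) (hB : 0 ≤ B)
    (hg : ContDiff ℝ ∞ g) (h : DerivBound n B (innerCube d η) g) (hx : x ∈ innerCube d η) :
    |localError n N η g x| ≤ B * (d / N) ^ n := by
  refine abs_sum_bump_mul_le (mem_Icc_of_mem_innerCube hη0 hx) fun m hm => ?_
  simpa using abs_sub_taylorPoly_node_le hN hη hB hg h hx
    fun i => (abs_lt_one_of_bump_ne_zero hm i).le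

theorem abs_add_smul_sub_sub_le (hxy : ∀ i, |N * x i - N * y i| ≤ 1) {m : Fin d → Fin (N + 1)}
    (hm : bump N m y ≠ 0) {τ : ℝ} (hτ : τ ∈ Icc (0 : ℝ) 1) (i : Fin d) :
    |N * (y + τ • (x - y)) i - m i| ≤ 2 := by
  have hsplit : N * (y + τ • (x - y)) i - m i
      = (N * y i - m i) + τ * (N * x i - N * y i) := by
    simp only [PiLp.add_apply, PiLp.smul_apply, PiLp.sub_apply, smul_eq_mul]
    ring
  have hstep : |τ * (N * x i - N * y i)| ≤ 1 := by
    rw [abs_mul, abs_of_nonneg hτ.1]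
    exact mul_le_one₀ hτ.2 (abs_nonneg _) (hxy i)
  rw [hsplit]
  linarith [abs_add_le (N * y i - m i) (τ * (N * x i - N * y i)),
    abs_lt_one_of_bump_ne_zero hm i]

theorem abs_taylorRemainder_node_sub_le (hN : 0 < N) (hη : η ≤ 1 / 2) (hB : 0 ≤ B)
    (hg : ContDiff ℝ ∞ g) (h : DerivBound (n + 1) B (innerCube d η) g) (hx : x ∈ innerCube d η)
    (hy : y ∈ innerCube d η) (hxy : ∀ i, |N * x i - N * y i| ≤ 1) {m : Fin d → Fin (N + 1)}
    (hm : bump N m y ≠ 0) :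
    |(g x - taylorPoly (n + 1) g (node N η m) x) - (g y - taylorPoly (n + 1) g (node N η m) y)|
      ≤ normOne (x - y) * (B * (d * 2 / N) ^ n) :=
  have hconvex := convex_innerCube η
  abs_taylorRemainder_sub_le hB hconvex hg hy hx
    (fun i _ hu => abs_taylorRemainder_le hB hconvex (contDiff_partialDeriv hg i)
      (h.partialDeriv i) (node_mem_innerCube hη m) hu)
    fun _ hτ => normOne_sub_node_le hN (hconvex.add_smul_sub_mem hy hx hτ)
      (abs_add_smul_sub_sub_le hxy hm hτ)

theorem abs_localError_sub_localError_le (hN : 0 < N) (hη0 : 0 ≤ η) (hη : η ≤ 1 / 2) (hB : 0 ≤ B)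
    (hg : ContDiff ℝ ∞ g) (h : DerivBound (n + 1) B (innerCube d η) g) (hx : x ∈ innerCube d η)
    (hy : y ∈ innerCube d η) (hxy : ∀ i, |N * x i - N * y i| ≤ 1) :
    |localError (n + 1) N η g x - localError (n + 1) N η g y|
      ≤ (5 ^ d * (2 * d) + 1) * B * (2 * d / N) ^ n * normOne (x - y) := by
  let R : (Fin d → Fin (N + 1)) → EuclideanSpace ℝ (Fin d) → ℝ :=
    fun m x => g x - taylorPoly (n + 1) g (node N η m) x
  have hsplit : localError (n + 1) N η g x - localError (n + 1) N η g y
      = ∑ m, (bump N m x - bump N m y) * R m x + ∑ m, bump N m y * (R m x - R m y) := by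
    rw [localError, localError, ← Finset.sum_sub_distrib, ← Finset.sum_add_distrib]
    refine Finset.sum_congr rfl fun m _ => ?_
    simp only [R]
    ring
  have hbump : |∑ m, (bump N m x - bump N m y) * R m x|
      ≤ 5 ^ d * (N * normOne (x - y) * (B * (d * 2 / N) ^ (n + 1))) :=
    abs_sum_bump_sub_bump_mul_le hxy (by positivity) fun m hm =>
      abs_sub_taylorPoly_node_le hN hη hB hg h hx fun i => (hm i).le
  have hremainder : |∑ m, bump N m y * (R m x - R m y)|
      ≤ normOne (x - y) * (B * (d * 2 / N) ^ n) :=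
    abs_sum_bump_mul_le (mem_Icc_of_mem_innerCube hη0 hy) fun m hm =>
      abs_taylorRemainder_node_sub_le hN hη hB hg h hx hy hxy hm
  rw [hsplit]
  refine (abs_add_le _ _).trans ((add_le_add hbump hremainder).trans_eq ?_)
  have hN' : (N : ℝ) ≠ 0 := by exact_mod_cast hN.ne'
  rw [pow_succ]
  field_simp

theorem exists_sub_sum_localMonomial_eq_localError (N : ℕ) (hη0 : 0 ≤ η) (hη : η ≤ 1 / 2)
    (hB : 0 ≤ B) (h : DerivBound n B (innerCube d η) g) :
    ∃ c : LocalIndex d n N → ℝ,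
      (∀ a, |c a| ≤ n * (d + 1) ^ n * B) ∧ ∀ x ∈ innerCube d η,
        g x - ∑ a, c a * localMonomial N a x = localError n N η g x := by
  have hpoly := fun m : Fin d → Fin (N + 1) => isBddPoly_taylorPoly n hB h
    (node_mem_innerCube hη m) (mem_Icc_of_mem_innerCube hη0 (node_mem_innerCube hη m))
  choose c hc hp using hpoly
  refine ⟨fun a => c a.1 a.2, fun a => hc _ _, fun x hx => ?_⟩
  rw [localError]
  simp only [mul_sub, Finset.sum_sub_distrib, ← Finset.sum_mul,
    sum_bump (mem_Icc_of_mem_innerCube hη0 hx), one_mul, hp, Fintype.sum_prod_type, localMonomial,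
    Finset.mul_sum]
  congr 1
  refine Finset.sum_congr rfl fun m _ => Finset.sum_congr rfl fun r _ => ?_
  ring

end LocalTaylor

/-! ### Iterated partial derivatives -/

section WordDeriv

variable {d : ℕ} {g ψ φ f : EuclideanSpace ℝ (Fin d) → ℝ}

theorem wordDeriv_append (v w : List (Fin d)) (g : EuclideanSpace ℝ (Fin d) → ℝ) :
    wordDeriv (v ++ w) g = wordDeriv w (wordDeriv v g) := by
  induction v generalizing g with
  | nil => rfl
  | cons i _ ih => exact ih _

theorem wordDeriv_replicate (k : ℕ) (i : Fin d) (g : EuclideanSpace ℝ (Fin d) → ℝ) :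
    wordDeriv (List.replicate k i) g = (partialDeriv i)^[k] g := by
  induction k generalizing g with
  | zero => rfl
  | succ _ ih => exact ih _

theorem wordDeriv_eq_of_perm {v w : List (Fin d)} (h : v.Perm w) (hg : ContDiff ℝ ∞ g) :
    wordDeriv v g = wordDeriv w g := by
  induction h generalizing g with
  | nil => rfl
  | cons i _ ih => exact ih (contDiff_partialDeriv hg i)
  | swap i j w =>
    simp only [wordDeriv, partialDeriv_comm (contDiff_infty.1 hg 2) i j]
  | trans _ _ ih₁ ih₂ => exact (ih₁ hg).trans (ih₂ hg)

theorem multiDeriv_eq_wordDeriv (α : Fin d → ℕ) (g : EuclideanSpace ℝ (Fin d) → ℝ) :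
    multiDeriv α g
      = wordDeriv ((List.finRange d).reverse.flatMap fun i => List.replicate (α i) i) g := by
  rw [multiDeriv]
  induction List.finRange d with
  | nil => rfl
  | cons i l ih =>
    simp [ih, wordDeriv_append, wordDeriv_replicate]

theorem wordDeriv_eq_multiDeriv (w : List (Fin d)) (hg : ContDiff ℝ ∞ g) :
    wordDeriv w g = multiDeriv (fun i => w.count i) g := by
  rw [multiDeriv_eq_wordDeriv]
  refine wordDeriv_eq_of_perm (List.perm_iff_count.2 fun i => ?_) hg
  simp [List.count_flatMap, List.count_replicate, Function.comp_def, ← Fin.sum_univ_def]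

theorem sum_count_eq_length (w : List (Fin d)) : ∑ i, w.count i = w.length := by
  simpa using Multiset.sum_count_eq_card (m := (w : Multiset (Fin d))) fun i _ => Finset.mem_univ i

theorem wordDeriv_const_mul_comp_sub (w : List (Fin d)) (hψ : ContDiff ℝ ∞ ψ)
    (x : EuclideanSpace ℝ (Fin d)) (c : ℝ) :
    wordDeriv w (fun t => c * ψ (x - t))
      = fun t => c * (-1) ^ w.length * wordDeriv w ψ (x - t) := by
  induction w generalizing ψ c with
  | nil => simp [wordDeriv]
  | cons i w ih =>
    have hstep : partialDeriv i (fun t => c * ψ (x - t))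
        = fun t => -c * partialDeriv i ψ (x - t) := by
      funext t
      have hderiv : HasFDerivAt (fun t => c * ψ (x - t)) _ t :=
        ((hψ.differentiable (by simp) (x - t)).hasFDerivAt.comp t
          ((hasFDerivAt_id t).const_sub x)).const_mul c
      simp [partialDeriv, hderiv.fderiv]
    rw [wordDeriv, hstep, ih (contDiff_partialDeriv hψ i), wordDeriv, List.length_cons, pow_succ]
    funext t
    ring

theorem wordDeriv_convolution (L : ℝ →L[ℝ] ℝ →L[ℝ] ℝ) (hf : LocallyIntegrable f)
    (w : List (Fin d)) (hφ : ContDiff ℝ ∞ φ) (hc : HasCompactSupport φ) :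
    wordDeriv w (convolution f φ L volume) = convolution f (wordDeriv w φ) L volume := by
  induction w generalizing φ with
  | nil => rfl
  | cons i w ih =>
    have hφ₁ : ContDiff ℝ 1 φ := hφ.of_le (by simp)
    have hstep : partialDeriv i (convolution f φ L volume)
        = convolution f (partialDeriv i φ) L volume := by
      funext x
      rw [partialDeriv, (hc.hasFDerivAt_convolution_right L hf hφ₁ x).fderiv]
      exact convolution_precompR_apply L hf (hc.fderiv ℝ) (hφ₁.continuous_fderiv one_ne_zero) x _
    rw [wordDeriv, hstep, ih (contDiff_partialDeriv hφ i) (hc.fderiv_apply (𝕜 := ℝ) _), wordDeriv]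

end WordDeriv

/-! ### Mollification of Sobolev functions -/

section Mollify

variable {d : ℕ}

theorem isOpen_cube (d : ℕ) : IsOpen (cube d) := by
  have hcube : cube d = ⋂ i : Fin d, (fun θ : EuclideanSpace ℝ (Fin d) => θ i) ⁻¹' Ioo 0 1 := by
    ext θ
    simp [cube]
  rw [hcube]
  exact isOpen_iInter_of_finite fun i => isOpen_Ioo.preimage (by fun_prop)

theorem measurableSet_cube (d : ℕ) : MeasurableSet (cube d) :=
  (isOpen_cube d).measurableSet

theorem volume_cube_lt_top (d : ℕ) : volume (cube d) < ⊤ := by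
  have hcompact : IsCompact (WithLp.toLp 2 '' univ.pi fun _ : Fin d => Icc (0 : ℝ) 1) :=
    (isCompact_univ_pi fun _ => isCompact_Icc).image (PiLp.continuous_toLp 2 _)
  refine (measure_mono fun θ hθ => ?_).trans_lt hcompact.measure_lt_top
  exact ⟨fun i => θ i, fun i _ => Ioo_subset_Icc_self (hθ i), rfl⟩

instance (d : ℕ) : IsFiniteMeasure (cubeMeasure d) :=
  ⟨by rw [cubeMeasure, Measure.restrict_apply_univ]; exact volume_cube_lt_top d⟩

theorem locallyIntegrable_indicator_cube {f : EuclideanSpace ℝ (Fin d) → ℝ}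
    (hf : Integrable f (cubeMeasure d)) : LocallyIntegrable ((cube d).indicator f) :=
  ((integrable_indicator_iff (measurableSet_cube d)).2 hf).locallyIntegrable

/-- The mollification of `f`, extended by zero outside `Ω`, with the normalized bump `φ`. -/
def mollify (φ : ContDiffBump (0 : EuclideanSpace ℝ (Fin d)))
    (f : EuclideanSpace ℝ (Fin d) → ℝ) : EuclideanSpace ℝ (Fin d) → ℝ :=
  convolution ((cube d).indicator f) (φ.normed volume) (ContinuousLinearMap.lsmul ℝ ℝ).flip volume

variable (φ : ContDiffBump (0 : EuclideanSpace ℝ (Fin d))) {f g : EuclideanSpace ℝ (Fin d) → ℝ}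

theorem contDiff_mollify (hf : Integrable f (cubeMeasure d)) : ContDiff ℝ ∞ (mollify φ f) :=
  φ.hasCompactSupport_normed.contDiff_convolution_right _
    (locallyIntegrable_indicator_cube hf) φ.contDiff_normed

theorem convolution_indicator_cube_apply (f ρ : EuclideanSpace ℝ (Fin d) → ℝ)
    (x : EuclideanSpace ℝ (Fin d)) :
    convolution ((cube d).indicator f) ρ (ContinuousLinearMap.lsmul ℝ ℝ).flip volume x
      = ∫ t in cube d, f t * ρ (x - t) := by
  rw [convolution_def, ← integral_indicator (measurableSet_cube d)]
  congr 1
  funext t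
  by_cases ht : t ∈ cube d <;> simp [ht, mul_comm]

theorem support_normed_sub_subset (x : EuclideanSpace ℝ (Fin d)) :
    (Function.support fun t => φ.normed volume (x - t)) ⊆ Metric.closedBall x φ.rOut := by
  intro t ht
  have hball : x - t ∈ Function.support (φ.normed volume) := ht
  rw [ContDiffBump.support_normed_eq, mem_ball_zero_iff] at hball
  rw [Metric.mem_closedBall, dist_comm, dist_eq_norm]
  exact hball.le

theorem wordDeriv_mollify (hf : Integrable f (cubeMeasure d)) {w : List (Fin d)}
    (hg : IsWeakDeriv (fun i => w.count i) f g) {x : EuclideanSpace ℝ (Fin d)}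
    (hx : Metric.closedBall x φ.rOut ⊆ cube d) :
    wordDeriv w (mollify φ f) x = mollify φ g x := by
  let ψ := fun t => φ.normed volume (x - t)
  have hψ : ContDiff ℝ ∞ ψ := φ.contDiff_normed.comp (contDiff_const.sub contDiff_id)
  have hcompact : HasCompactSupport ψ :=
    .of_support_subset_isCompact (isCompact_closedBall _ _) (support_normed_sub_subset φ x)
  have htsupport : tsupport ψ ⊆ cube d :=
    (closure_minimal (support_normed_sub_subset φ x) Metric.isClosed_closedBall).trans hx
  have hparts := hg.2.2 ψ hψ hcompact htsupport
  have hψw : wordDeriv w ψ = fun t => (-1) ^ w.length * wordDeriv w (φ.normed volume) (x - t) := by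
    simpa using wordDeriv_const_mul_comp_sub w φ.contDiff_normed x 1
  rw [sum_count_eq_length, ← wordDeriv_eq_multiDeriv w hψ, hψw] at hparts
  simp only [mul_left_comm _ ((-1 : ℝ) ^ w.length), integral_const_mul] at hparts
  rw [mollify, wordDeriv_convolution _ (locallyIntegrable_indicator_cube hf) w φ.contDiff_normed
    φ.hasCompactSupport_normed, convolution_indicator_cube_apply, mollify,
    convolution_indicator_cube_apply]
  exact mul_left_cancel₀ (pow_ne_zero _ (by norm_num)) hparts

theorem abs_mollify_le {B : ℝ} (hB : 0 ≤ B) (hg : ∀ᵐ x ∂cubeMeasure d, |g x| ≤ B)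
    (x : EuclideanSpace ℝ (Fin d)) : |mollify φ g x| ≤ B := by
  have hρ : ∀ t, 0 ≤ φ.normed volume t := φ.nonneg_normed
  have hint : Integrable fun t => B * φ.normed volume (x - t) :=
    (φ.integrable_normed.comp_sub_left x).const_mul B
  rw [mollify, convolution_indicator_cube_apply, ← Real.norm_eq_abs]
  calc ‖∫ t in cube d, g t * φ.normed volume (x - t)‖
      ≤ ∫ t in cube d, B * φ.normed volume (x - t) := by
        refine norm_integral_le_of_norm_le hint.integrableOn ?_
        filter_upwards [hg] with t ht
        rw [norm_mul, Real.norm_of_nonneg (hρ _)]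
        exact mul_le_mul_of_nonneg_right ht (hρ _)
    _ ≤ ∫ t, B * φ.normed volume (x - t) :=
        setIntegral_le_integral hint (.of_forall fun t => mul_nonneg hB (hρ _))
    _ = B := by
        rw [integral_const_mul, integral_sub_left_eq_self (φ.normed volume) volume x,
          φ.integral_normed, mul_one]

theorem exists_isWeakDeriv_abs_le {n : ℕ} {B : ℝ} (hf : sobolevNormTop n f < ENNReal.ofReal B)
    {α : Fin d → ℕ} (hα : ∑ i, α i ≤ n) :
    ∃ g, IsWeakDeriv α f g ∧ ∀ᵐ x ∂cubeMeasure d, |g x| ≤ B := by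
  have hB : 0 < B := ENNReal.ofReal_pos.1 (pos_of_gt hf)
  have hlt := (le_iSup₂_of_le α hα le_rfl : _ ≤ sobolevNormTop n f).trans_lt hf
  simp only [iInf_lt_iff] at hlt
  obtain ⟨g, hg, hgB⟩ := hlt
  refine ⟨g, hg, ?_⟩
  rw [eLpNorm_exponent_top] at hgB
  filter_upwards [ae_le_eLpNormEssSup (f := g) (μ := cubeMeasure d)] with x hx
  have hxB := hx.trans hgB.le
  rwa [← ofReal_norm, ENNReal.ofReal_le_ofReal_iff hB.le] at hxB

theorem closedBall_subset_cube {η r : ℝ} (hr : r < η) {x : EuclideanSpace ℝ (Fin d)}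
    (hx : x ∈ innerCube d η) : Metric.closedBall x r ⊆ cube d := by
  intro t ht i
  rw [Metric.mem_closedBall, dist_eq_norm] at ht
  obtain ⟨hlower, hupper⟩ := abs_le.1 ((PiLp.norm_apply_le (t - x) i).trans ht)
  rw [PiLp.sub_apply] at hlower hupper
  obtain ⟨hxlower, hxupper⟩ := hx i
  constructor <;> linarith

theorem derivBound_mollify {n : ℕ} {B η : ℝ} (hf : Integrable f (cubeMeasure d))
    (hnorm : sobolevNormTop n f < ENNReal.ofReal B) (hφ : φ.rOut < η) :
    DerivBound n B (innerCube d η) (mollify φ f) := by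
  intro w hw x hx
  obtain ⟨g, hg, hgB⟩ := exists_isWeakDeriv_abs_le hnorm ((sum_count_eq_length w).trans_le hw)
  rw [wordDeriv_mollify φ hf hg (closedBall_subset_cube hφ hx)]
  exact abs_mollify_le φ (ENNReal.ofReal_pos.1 (pos_of_gt hnorm)).le hgB x

/-- A sequence of bumps with radii tending to zero, `k ↦ 1 / (k + 3)`. -/
def mollifier (d k : ℕ) : ContDiffBump (0 : EuclideanSpace ℝ (Fin d)) where
  rIn := 1 / (2 * (k + 3))
  rOut := 1 / (k + 3)
  rIn_pos := by positivity
  rIn_lt_rOut := one_div_lt_one_div_of_lt (by positivity) (lt_two_mul_self (by positivity))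

theorem tendsto_one_div_natCast_add (c : ℝ) :
    Filter.Tendsto (fun k : ℕ => 1 / ((k : ℝ) + c)) Filter.atTop (nhds 0) :=
  tendsto_const_nhds.div_atTop
    (Filter.tendsto_atTop_add_const_right _ c tendsto_natCast_atTop_atTop)

theorem ae_tendsto_mollify (hf : Integrable f (cubeMeasure d)) :
    ∀ᵐ x ∂cubeMeasure d,
      Filter.Tendsto (fun k => mollify (mollifier d k) f x) Filter.atTop (nhds (f x)) := by
  have hlebesgue := ContDiffBump.ae_convolution_tendsto_right_of_locallyIntegrable (μ := volume)
    (φ := mollifier d) (K := 2) (tendsto_one_div_natCast_add 3)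
    (.of_forall fun k => le_of_eq (by simp only [mollifier]; field_simp))
    (locallyIntegrable_indicator_cube hf)
  filter_upwards [ae_restrict_of_ae hlebesgue, ae_restrict_mem (measurableSet_cube d)]
    with x hx hxcube
  rw [indicator_of_mem hxcube] at hx
  refine hx.congr fun k => ?_
  rw [mollify, convolution_flip]

theorem eventually_mem_innerCube {x : EuclideanSpace ℝ (Fin d)} (hx : x ∈ cube d) :
    ∀ᶠ k : ℕ in Filter.atTop, x ∈ innerCube d (1 / (k + 2)) := by
  have hlim := tendsto_one_div_natCast_add 2
  refine Filter.eventually_all.2 fun i => ?_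
  filter_upwards [hlim.eventually_lt_const (hx i).1,
    hlim.eventually_lt_const (sub_pos.2 (hx i).2)] with k hlower hupper
  exact ⟨hlower.le, by linarith⟩

end Mollify

/-! ### Hölder estimates -/

section BoundedHolder

/-- `e` is bounded by `C` on `S`, and `s`-Hölder continuous there with constant `C`. -/
structure BoundedHolderOn {X : Type*} [PseudoMetricSpace X] (s C : ℝ) (S : Set X) (e : X → ℝ) :
    Prop where
  bound : ∀ x ∈ S, |e x| ≤ C
  holder : ∀ x ∈ S, ∀ y ∈ S, |e x - e y| ≤ C * dist x y ^ s

namespace BoundedHolderOn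

variable {X : Type*} [PseudoMetricSpace X] {s C C' : ℝ} {S T : Set X} {e e' : X → ℝ}

theorem mono (h : BoundedHolderOn s C S e) (hC : C ≤ C') : BoundedHolderOn s C' S e :=
  ⟨fun x hx => (h.bound x hx).trans hC, fun x hx y hy => (h.holder x hx y hy).trans (by gcongr)⟩

theorem mono_set (h : BoundedHolderOn s C S e) (hT : T ⊆ S) : BoundedHolderOn s C T e :=
  ⟨fun x hx => h.bound x (hT hx), fun x hx y hy => h.holder x (hT hx) y (hT hy)⟩

theorem congr (h : BoundedHolderOn s C S e) (he : EqOn e e' S) : BoundedHolderOn s C S e' :=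
  ⟨fun x hx => he hx ▸ h.bound x hx, fun x hx y hy => he hx ▸ he hy ▸ h.holder x hx y hy⟩

theorem const (c : ℝ) : BoundedHolderOn s |c| S (fun _ => c) :=
  ⟨fun _ _ => le_rfl, fun x _ y _ => by rw [sub_self, abs_zero]; positivity⟩

theorem add (h : BoundedHolderOn s C S e) (h' : BoundedHolderOn s C' S e') :
    BoundedHolderOn s (C + C') S (fun x => e x + e' x) := by
  refine ⟨fun x hx => (abs_add_le _ _).trans (add_le_add (h.bound x hx) (h'.bound x hx)),
    fun x hx y hy => ?_⟩
  rw [add_sub_add_comm, add_mul]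
  exact (abs_add_le _ _).trans (add_le_add (h.holder x hx y hy) (h'.holder x hx y hy))

theorem const_mul (h : BoundedHolderOn s C S e) (t : ℝ) :
    BoundedHolderOn s (|t| * C) S (fun x => t * e x) := by
  refine ⟨fun x hx => ?_, fun x hx y hy => ?_⟩
  · rw [abs_mul]
    exact mul_le_mul_of_nonneg_left (h.bound x hx) (abs_nonneg _)
  · rw [← mul_sub, abs_mul, mul_assoc]
    exact mul_le_mul_of_nonneg_left (h.holder x hx y hy) (abs_nonneg _)

theorem sub (h : BoundedHolderOn s C S e) (h' : BoundedHolderOn s C' S e') :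
    BoundedHolderOn s (C + C') S (fun x => e x - e' x) := by
  simpa [sub_eq_add_neg] using h.add (h'.const_mul (-1))

theorem sum {ι : Type*} (t : Finset ι) {C : ι → ℝ} {e : ι → X → ℝ}
    (h : ∀ i, BoundedHolderOn s (C i) S (e i)) :
    BoundedHolderOn s (∑ i ∈ t, C i) S (fun x => ∑ i ∈ t, e i x) := by
  classical
  induction t using Finset.induction_on with
  | empty => simpa using const (s := s) (S := S) 0
  | insert j t hj ih =>
    simp only [Finset.sum_insert hj]
    exact (h j).add ih

theorem mul (hC : 0 ≤ C) (h : BoundedHolderOn s C S e) (h' : BoundedHolderOn s C' S e') :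
    BoundedHolderOn s (2 * C * C') S (fun x => e x * e' x) := by
  refine ⟨fun x hx => ?_, fun x hx y hy => ?_⟩
  · have hC' : 0 ≤ C' := (abs_nonneg _).trans (h'.bound x hx)
    rw [abs_mul]
    have := mul_le_mul (h.bound x hx) (h'.bound x hx) (abs_nonneg _) hC
    nlinarith [mul_nonneg hC hC']
  · rw [show e x * e' x - e y * e' y = (e x - e y) * e' x + e y * (e' x - e' y) by ring]
    refine (abs_add_le _ _).trans ?_
    rw [abs_mul, abs_mul]
    have h1 := mul_le_mul (h.holder x hx y hy) (h'.bound x hx) (abs_nonneg _) (by positivity)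
    have h2 := mul_le_mul (h.bound y hy) (h'.holder x hx y hy) (abs_nonneg _) hC
    linarith

/-- Beyond the scale `1 / M` the uniform bound is already a Hölder bound. -/
theorem of_local_lipschitz (hs0 : 0 ≤ s) (hs1 : s ≤ 1) {L M : ℝ} (hM : 1 ≤ M)
    (hbound : ∀ x ∈ S, 2 * |e x| ≤ L)
    (hlip : ∀ x ∈ S, ∀ y ∈ S, M * dist x y ≤ 1 → |e x - e y| ≤ L * (M * dist x y)) :
    BoundedHolderOn s (L * M ^ s) S e := by
  have hM0 : 0 ≤ M := zero_le_one.trans hM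
  have hL : ∀ x ∈ S, 0 ≤ L := fun x hx => (by positivity : 0 ≤ 2 * |e x|).trans (hbound x hx)
  refine ⟨fun x hx => ?_, fun x hx y hy => ?_⟩
  · calc |e x| ≤ L := by linarith [hbound x hx, abs_nonneg (e x)]
      _ ≤ L * M ^ s := le_mul_of_one_le_right (hL x hx) (Real.one_le_rpow hM hs0)
  · have ht : 0 ≤ M * dist x y := by positivity
    rw [mul_assoc, ← Real.mul_rpow hM0 dist_nonneg]
    rcases le_total (M * dist x y) 1 with h1 | h1
    · refine (hlip x hx y hy h1).trans (mul_le_mul_of_nonneg_left ?_ (hL x hx))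
      exact Real.self_le_rpow_of_le_one ht h1 hs1
    · calc |e x - e y| ≤ L := (abs_sub _ _).trans (by linarith [hbound x hx, hbound y hy])
        _ ≤ L * (M * dist x y) ^ s :=
          le_mul_of_one_le_right (hL x hx) (Real.one_le_rpow h1 hs0)

end BoundedHolderOn

end BoundedHolder

/-! ### Limits of smooth functions -/

section SmoothLimit

variable {d n : ℕ} {s B : ℝ} {S : Set (EuclideanSpace ℝ (Fin d))}
  {f : EuclideanSpace ℝ (Fin d) → ℝ}

/-- `f` is on `S ⊆ Ω` the pointwise limit of smooth functions whose derivatives up to order `n` are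
bounded by `B` on an exhaustion of `Ω`. This turns almost everywhere statements about `W^{n,∞}` into
everywhere statements on a set of full measure. -/
def IsSmoothLimitOn (n : ℕ) (B : ℝ) (S : Set (EuclideanSpace ℝ (Fin d)))
    (f : EuclideanSpace ℝ (Fin d) → ℝ) : Prop :=
  S ⊆ cube d ∧ ∃ g : ℕ → EuclideanSpace ℝ (Fin d) → ℝ, (∀ k, ContDiff ℝ ∞ (g k)) ∧
    (∀ k : ℕ, DerivBound n B (innerCube d (1 / (k + 2))) (g k)) ∧
    ∀ x ∈ S, Filter.Tendsto (fun k => g k x) Filter.atTop (nhds (f x))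

theorem exists_isSmoothLimitOn (hf : Integrable f (cubeMeasure d))
    (hnorm : sobolevNormTop n f < ENNReal.ofReal B) :
    ∃ S, (∀ᵐ x ∂cubeMeasure d, x ∈ S) ∧ IsSmoothLimitOn n B S f := by
  refine ⟨{x | x ∈ cube d ∧ Filter.Tendsto (fun k => mollify (mollifier d k) f x) Filter.atTop
      (nhds (f x))}, ?_, fun x hx => hx.1, fun k => mollify (mollifier d k) f,
    fun k => contDiff_mollify _ hf, fun k => derivBound_mollify _ hf hnorm ?_, fun x hx => hx.2⟩
  · filter_upwards [ae_restrict_mem (measurableSet_cube d), ae_tendsto_mollify hf] with x hx hlim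
    exact ⟨hx, hlim⟩
  · exact one_div_lt_one_div_of_lt (by positivity) (by linarith)

theorem DerivBound.abs_sub_le {Q : Set (EuclideanSpace ℝ (Fin d))} (hB : 0 ≤ B)
    (hQ : Convex ℝ Q) {g : EuclideanSpace ℝ (Fin d) → ℝ} (hg : ContDiff ℝ ∞ g)
    (h : DerivBound 1 B Q g) {x y : EuclideanSpace ℝ (Fin d)} (hx : x ∈ Q) (hy : y ∈ Q) :
    |g x - g y| ≤ B * normOne (x - y) := by
  simpa [taylorPoly, taylorTerm] using abs_taylorRemainder_le hB hQ hg h hy hx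

theorem one_div_add_two_le (k : ℕ) : 1 / ((k : ℝ) + 2) ≤ 1 / 2 :=
  one_div_le_one_div_of_le two_pos (le_add_of_nonneg_left k.cast_nonneg)

theorem abs_natCast_mul_sub_natCast_mul_le (N : ℕ) (x y : EuclideanSpace ℝ (Fin d)) (i : Fin d) :
    |N * x i - N * y i| ≤ N * ‖x - y‖ := by
  rw [← mul_sub, abs_mul, Nat.abs_cast]
  exact mul_le_mul_of_nonneg_left (PiLp.norm_apply_le (x - y) i) N.cast_nonneg

theorem exists_tendsto_localError (hB : 0 ≤ B) {g : ℕ → EuclideanSpace ℝ (Fin d) → ℝ}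
    (hgB : ∀ k : ℕ, DerivBound n B (innerCube d (1 / (k + 2))) (g k)) (N : ℕ) :
    ∃ c : LocalIndex d n N → ℝ, (∀ a, |c a| ≤ n * (d + 1) ^ n * B) ∧
      ∃ φ : ℕ → ℕ, StrictMono φ ∧ ∀ x ∈ cube d, ∀ y,
        Filter.Tendsto (fun k => g k x) Filter.atTop (nhds y) →
        Filter.Tendsto (fun k => localError n N (1 / ((φ k : ℝ) + 2)) (g (φ k)) x) Filter.atTop
          (nhds (y - ∑ a, c a * localMonomial N a x)) := by
  choose c hcA hc using fun k : ℕ => exists_sub_sum_localMonomial_eq_localError N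
    (by positivity : (0 : ℝ) ≤ 1 / (k + 2)) (one_div_add_two_le k) hB (hgB k)
  obtain ⟨c', -, φ, hφ, hφl⟩ := tendsto_subseq_of_bounded
    (Metric.isBounded_closedBall (x := 0) (r := n * (d + 1) ^ n * B)) (x := c) fun k => by
      rw [mem_closedBall_zero_iff, pi_norm_le_iff_of_nonneg (by positivity)]
      exact hcA k
  have hφl' : ∀ a, Filter.Tendsto (fun k => c (φ k) a) Filter.atTop (nhds (c' a)) :=
    tendsto_pi_nhds.1 hφl
  refine ⟨c', fun a => le_of_tendsto (hφl' a).abs (Filter.Eventually.of_forall fun k => hcA _ _),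
    φ, hφ, fun x hx y hy => ?_⟩
  refine ((hy.comp hφ.tendsto_atTop).sub
    (tendsto_finsetSum _ fun a _ => (hφl' a).mul_const _)).congr' ?_
  filter_upwards [hφ.tendsto_atTop.eventually (eventually_mem_innerCube hx)] with k hk
  exact hc _ x hk

namespace IsSmoothLimitOn

theorem boundedHolderOn (hs0 : 0 ≤ s) (hs1 : s ≤ 1) (hB : 0 ≤ B)
    (h : IsSmoothLimitOn (n + 1) B S f) : BoundedHolderOn s ((d + 2) * B) S f := by
  obtain ⟨hS, g, hg, hgB, hlim⟩ := h
  have habs : ∀ x ∈ S, |f x| ≤ B := fun x hx => by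
    refine le_of_tendsto (hlim x hx).abs ?_
    filter_upwards [eventually_mem_innerCube (hS hx)] with k hk
    exact (hgB k).abs_le hk
  have hlip : ∀ x ∈ S, ∀ y ∈ S, |f x - f y| ≤ B * normOne (x - y) := fun x hx y hy => by
    refine le_of_tendsto ((hlim x hx).sub (hlim y hy)).abs ?_
    filter_upwards [eventually_mem_innerCube (hS hx), eventually_mem_innerCube (hS hy)]
      with k hkx hky
    exact ((hgB k).mono (by omega)).abs_sub_le hB (convex_innerCube _) (hg k) hkx hky
  have key := BoundedHolderOn.of_local_lipschitz (S := S) (e := f) (L := (d + 2) * B) hs0 hs1 le_rfl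
    (fun x hx => by nlinarith [habs x hx, mul_nonneg d.cast_nonneg hB]) fun x hx y hy _ => by
      rw [one_mul, dist_eq_norm]
      calc |f x - f y| ≤ B * (d * ‖x - y‖) :=
            (hlip x hx y hy).trans (mul_le_mul_of_nonneg_left (normOne_le _) hB)
        _ ≤ (d + 2) * B * ‖x - y‖ := by nlinarith [mul_nonneg hB (norm_nonneg (x - y))]
  rwa [Real.one_rpow, mul_one] at key

theorem exists_boundedHolderOn_sub (hs0 : 0 ≤ s) (hs1 : s ≤ 1) (hB : 0 ≤ B)
    (h : IsSmoothLimitOn (n + 1) B S f) {N : ℕ} (hN : 0 < N) :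
    ∃ c : LocalIndex d (n + 1) N → ℝ, (∀ a, |c a| ≤ (n + 1 : ℕ) * (d + 1) ^ (n + 1) * B) ∧
      BoundedHolderOn s ((5 ^ d * (2 * d) + 1) * B * (2 * d / N) ^ (n + 1) * N ^ s) S
        (fun x => f x - ∑ a, c a * localMonomial N a x) := by
  obtain ⟨hS, g, hg, hgB, hlim⟩ := h
  obtain ⟨c, hc, φ, hφ, hφl⟩ := exists_tendsto_localError hB hgB N
  have hev : ∀ x ∈ S, ∀ᶠ k in Filter.atTop, x ∈ innerCube d (1 / ((φ k : ℝ) + 2)) := fun x hx =>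
    hφ.tendsto_atTop.eventually (eventually_mem_innerCube (hS hx))
  have hη : ∀ k : ℕ, (0 : ℝ) ≤ 1 / (k + 2) := fun k => by positivity
  refine ⟨c, hc, .of_local_lipschitz hs0 hs1 (mod_cast hN) (fun x hx => ?_) fun x hx y hy hxy => ?_⟩
  · have hx' := hφl x (hS hx) _ (hlim x hx)
    have habs : |f x - ∑ a, c a * localMonomial N a x| ≤ B * (d / N) ^ (n + 1) := by
      refine le_of_tendsto hx'.abs ?_
      filter_upwards [hev x hx] with k hk
      exact abs_localError_le hN (hη _) (one_div_add_two_le _) hB (hg _) (hgB _) hk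
    calc 2 * |f x - ∑ a, c a * localMonomial N a x|
        ≤ 1 * B * (2 ^ (n + 1) * (d / N) ^ (n + 1)) := by
          nlinarith [mul_nonneg hB (by positivity : (0 : ℝ) ≤ (d / N) ^ (n + 1)),
            one_le_pow₀ (one_le_two : (1 : ℝ) ≤ 2) (n := n), pow_succ (2 : ℝ) n]
      _ ≤ (5 ^ d * (2 * d) + 1) * B * (2 * d / N) ^ (n + 1) := by
          rw [← mul_pow, ← mul_div_assoc]
          gcongr
          exact le_add_of_nonneg_left (by positivity)
  · rw [dist_eq_norm] at hxy ⊢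
    have hxy' : ∀ i, |N * x i - N * y i| ≤ 1 := fun i =>
      (abs_natCast_mul_sub_natCast_mul_le N x y i).trans hxy
    have hlip : |(f x - ∑ a, c a * localMonomial N a x) - (f y - ∑ a, c a * localMonomial N a y)|
        ≤ (5 ^ d * (2 * d) + 1) * B * (2 * d / N) ^ n * normOne (x - y) := by
      refine le_of_tendsto ((hφl x (hS hx) _ (hlim x hx)).sub
        (hφl y (hS hy) _ (hlim y hy))).abs ?_
      filter_upwards [hev x hx, hev y hy] with k hkx hky
      exact abs_localError_sub_localError_le hN (hη _) (one_div_add_two_le _) hB (hg _) (hgB _)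
        hkx hky hxy'
    calc _ ≤ (5 ^ d * (2 * d) + 1) * B * (2 * d / N) ^ n * (2 * (d * ‖x - y‖)) := by
          refine hlip.trans (mul_le_mul_of_nonneg_left ?_ (by positivity))
          linarith [normOne_le (x - y), normOne_nonneg (x - y)]
      _ = (5 ^ d * (2 * d) + 1) * B * (2 * d / N) ^ (n + 1) * (N * ‖x - y‖) := by
          rw [pow_succ]
          field_simp

end IsSmoothLimitOn

end SmoothLimit

/-! ### The network basis functions -/

section NetMonomial

variable {d n : ℕ} [NeZero d] {N : ℕ} {x y : EuclideanSpace ℝ (Fin d)}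

/-- The coordinates, slopes and offsets of the hat functions whose product is a localized monomial
on `Ω`: there `x i = hat (x i - 1)`. -/
def factorData (N : ℕ) (a : LocalIndex d n N) : Fin (d + n) → Fin d × ℝ × ℝ :=
  Fin.append (fun i => (i, (N : ℝ), (a.1 i : ℝ))) fun j => match a.2 j with
    | none => (0, 0, 0)
    | some i => (i, 1, 1)

/-- The factors of a localized monomial, as hat functions. -/
def factor (N : ℕ) (a : LocalIndex d n N) (x : EuclideanSpace ℝ (Fin d)) (l : Fin (d + n)) : ℝ :=
  hat ((factorData N a l).2.1 * x (factorData N a l).1 - (factorData N a l).2.2)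

/-- The function computed by the network in place of a localized monomial. -/
def netMonomial (k N : ℕ) (a : LocalIndex d n N) (x : EuclideanSpace ℝ (Fin d)) : ℝ :=
  prodApprox k (factor N a x) (List.finRange (d + n)) 1

theorem prod_factor (a : LocalIndex d n N) (hx : x ∈ cube d) :
    ∏ l, factor N a x l = localMonomial N a x := by
  rw [Fin.prod_univ_add, localMonomial, bump]
  congr 1
  · simp [factor, factorData]
  · refine Finset.prod_congr rfl fun j _ => ?_
    simp only [factor, factorData, Fin.append_right]
    rcases a.2 j with _ | i
    · simp [hat, coordOrOne]
    · have := hx i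
      simp only [hat, coordOrOne, one_mul]
      rw [abs_of_nonpos (by linarith [this.2]), max_eq_right (by linarith [this.1])]
      ring

theorem abs_netMonomial_sub_le (k : ℕ) (a : LocalIndex d n N) (hx : x ∈ cube d) :
    |localMonomial N a x - netMonomial k N a x| ≤ (d + n : ℕ) * (1 / 4 ^ k) := by
  have h := abs_prodApprox_sub_le k (u := factor N a x) (fun l => hat_mem _)
    (List.finRange (d + n)) (p := 1) ⟨zero_le_one, le_rfl⟩ 1
  rw [← List.ofFn_eq_map, List.prod_ofFn, prod_factor a hx] at h
  rw [abs_sub_comm]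
  simpa [netMonomial] using h

theorem abs_factor_sub_le (hN : 0 < N) (a : LocalIndex d n N) (x y : EuclideanSpace ℝ (Fin d))
    (l : Fin (d + n)) : |factor N a x l - factor N a y l| ≤ N * dist x y := by
  refine (abs_hat_sub_hat_le _ _).trans ?_
  rw [sub_sub_sub_cancel_right, ← mul_sub, abs_mul, dist_eq_norm]
  refine mul_le_mul ?_ (PiLp.norm_apply_le (x - y) _) (abs_nonneg _) (by positivity)
  refine Fin.addCases (fun i => ?_) (fun j => ?_) l
  · simp [factorData]
  · simp only [factorData, Fin.append_right]
    rcases a.2 j with _ | i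
    · simp
    · simpa using Nat.one_le_iff_ne_zero.2 hN.ne'

theorem abs_monomialError_sub_le (hN : 0 < N) (k : ℕ) (a : LocalIndex d n N) (hx : x ∈ cube d)
    (hy : y ∈ cube d) :
    |(localMonomial N a x - netMonomial k N a x) - (localMonomial N a y - netMonomial k N a y)|
      ≤ ((d + n : ℕ) + 4 ^ (d + n)) * (N * dist x y) := by
  have hfac := abs_factor_sub_le hN a x y
  have hmonomial : |localMonomial N a x - localMonomial N a y| ≤ (d + n : ℕ) * (N * dist x y) := by
    rw [← prod_factor a hx, ← prod_factor a hy]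
    refine (abs_prod_sub_prod_le _ (fun l => hat_mem _) fun l => hat_mem _).trans ?_
    refine (Finset.sum_le_card_nsmul _ _ _ fun l _ => hfac l).trans ?_
    simp
  have hnet := abs_prodApprox_sub_prodApprox_le k (by positivity) hfac
    (List.finRange (d + n)) 1 1
  rw [List.length_finRange, sub_self, abs_zero, zero_add] at hnet
  rw [sub_sub_sub_comm, add_mul]
  exact (abs_sub _ _).trans (add_le_add hmonomial hnet)

end NetMonomial

/-! ### Approximation of Sobolev functions by networks -/

section Approximation

variable {d n D k N q : ℕ} {s : ℝ}

theorem pow_rpow_div_pow_le {t : ℝ} (ht : 1 ≤ t) {r : ℕ} (hq : (r : ℝ) ≤ q * (1 - s)) :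
    (t ^ (q + 1)) ^ s / t ^ q ≤ t ^ s / t ^ r := by
  have ht0 : 0 < t := zero_lt_one.trans_le ht
  rw [← Real.rpow_natCast, ← Real.rpow_natCast, ← Real.rpow_natCast, ← Real.rpow_mul ht0.le,
    ← Real.rpow_sub ht0, ← Real.rpow_sub ht0]
  refine Real.rpow_le_rpow_of_exponent_le ht ?_
  push_cast
  linarith

theorem card_localIndex (d n N : ℕ) :
    Fintype.card (LocalIndex d n N) = (N + 1) ^ d * (d + 1) ^ n := by
  simp

variable [NeZero d]

theorem boundedHolderOn_monomialError (hN : 0 < N) (hs0 : 0 ≤ s) (hs1 : s ≤ 1)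
    (hq : (d + n : ℕ) ≤ q * (1 - s)) (hk : N ^ q ≤ 4 ^ k) (a : LocalIndex d n N) :
    BoundedHolderOn s ((2 * (d + n : ℕ) + 4 ^ (d + n)) * (N ^ s / N ^ (d + n))) (cube d)
      (fun x => localMonomial N a x - netMonomial k N a x) := by
  have hN1 : (1 : ℝ) ≤ N := mod_cast hN
  set H : ℝ := 2 * (d + n : ℕ) + 4 ^ (d + n)
  have hpow : (1 : ℝ) / 4 ^ k ≤ 1 / N ^ q :=
    one_div_le_one_div_of_le (by positivity) (mod_cast hk)
  have key : BoundedHolderOn s (H / N ^ q * ((N : ℝ) ^ (q + 1)) ^ s) (cube d)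
      (fun x => localMonomial N a x - netMonomial k N a x) := by
    refine .of_local_lipschitz hs0 hs1 (one_le_pow₀ hN1) (fun x hx => ?_) fun x hx y hy _ => ?_
    · calc 2 * |localMonomial N a x - netMonomial k N a x|
          ≤ 2 * ((d + n : ℕ) * (1 / N ^ q)) := by
            refine mul_le_mul_of_nonneg_left ?_ zero_le_two
            exact (abs_netMonomial_sub_le k a hx).trans (by gcongr)
        _ = 2 * (d + n : ℕ) / N ^ q := by ring
        _ ≤ H / N ^ q := by
            gcongr
            exact le_add_of_nonneg_right (by positivity)
    · calc _ ≤ ((d + n : ℕ) + 4 ^ (d + n)) * (N * dist x y) :=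
            abs_monomialError_sub_le hN k a hx hy
        _ ≤ H * (N * dist x y) := by
            refine mul_le_mul_of_nonneg_right ?_ (by positivity)
            linarith [(d + n).cast_nonneg (α := ℝ)]
        _ = H / N ^ q * (N ^ (q + 1) * dist x y) := by
            rw [pow_succ]
            field_simp
  refine key.mono ?_
  rw [div_mul_eq_mul_div, mul_div_assoc]
  exact mul_le_mul_of_nonneg_left (pow_rpow_div_pow_le hN1 hq) (by positivity)

theorem boundedHolderOn_sum_monomialError (hN : 0 < N) (hs0 : 0 ≤ s) (hs1 : s ≤ 1)
    (hq : (d + n : ℕ) ≤ q * (1 - s)) (hk : N ^ q ≤ 4 ^ k) {c : LocalIndex d n N → ℝ} {A : ℝ}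
    (hc : ∀ a, |c a| ≤ A) :
    BoundedHolderOn s
      (2 ^ d * (d + 1) ^ n * A * (2 * (d + n : ℕ) + 4 ^ (d + n)) * (N ^ s / N ^ n)) (cube d)
      (fun x => ∑ a, c a * (localMonomial N a x - netMonomial k N a x)) := by
  have hN1 : (1 : ℝ) ≤ N := mod_cast hN
  have hA : 0 ≤ A := (abs_nonneg _).trans (hc ⟨fun _ => 0, fun _ => none⟩)
  set H : ℝ := 2 * (d + n : ℕ) + 4 ^ (d + n)
  refine (BoundedHolderOn.sum Finset.univ fun a =>
    (boundedHolderOn_monomialError hN hs0 hs1 hq hk a).const_mul (c a)).mono ?_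
  calc ∑ a, |c a| * (H * (N ^ s / N ^ (d + n)))
      ≤ ∑ _a : LocalIndex d n N, A * (H * (N ^ s / N ^ (d + n))) :=
        Finset.sum_le_sum fun a _ => mul_le_mul_of_nonneg_right (hc a) (by positivity)
    _ = (N + 1) ^ d * (d + 1) ^ n * (A * (H * (N ^ s / N ^ (d + n)))) := by
        rw [Finset.sum_const, Finset.card_univ, card_localIndex, nsmul_eq_mul]
        push_cast
        ring
    _ ≤ (2 * N) ^ d * (d + 1) ^ n * (A * (H * (N ^ s / N ^ (d + n)))) := by
        gcongr
        linarith
    _ = 2 ^ d * (d + 1) ^ n * A * H * (N ^ s / N ^ n) := by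
        rw [mul_pow, pow_add (N : ℝ) d n]
        field_simp

/-- A bound for the weights and units per output and layer of the networks that sum up the
`(N + 1) ^ d * (d + 1) ^ n` approximate localized monomials. -/
def layerSize (d n N : ℕ) : ℕ :=
  (N + 1) ^ d * (d + 1) ^ n * Fintype.card (Reg (d + n)) * (Fintype.card (Reg (d + n)) + d + 4)

theorem exists_net_eq_sum_netMonomial (k N : ℕ) (c : Fin D → LocalIndex d n N → ℝ) :
    ∃ net : ReLUNet D d, (∀ x j, net.toMap x j = ∑ a, c j a * netMonomial k N a x) ∧
      net.depth = (d + n) * (2 * k + 3) + 3 ∧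
      net.numWeights + net.numUnits ≤ layerSize d n N * (D + net.depth) := by
  obtain ⟨net, heval, hdepth, hsize⟩ := realizable_sum_prodApprox (d := d) k
    (fun a l => (factorData N a l).1) (fun a l => (factorData N a l).2.1)
    (fun a l => (factorData N a l).2.2) c d (Equiv.refl _)
  refine ⟨net, fun x j => congrFun (heval fun i => x i) j, hdepth, hsize.trans ?_⟩
  rw [hdepth, card_localIndex, layerSize]
  set R := Fintype.card (Reg (d + n))
  set m := (d + n) * (2 * k + 3)
  set a := (N + 1) ^ d * (d + 1) ^ n
  have haR : 0 < a * R := Nat.mul_pos (by positivity) (Fintype.card_pos_iff.2 ⟨.acc 0⟩)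
  have hD : D * (a * R) + D ≤ a * R * (R + d + 4) * D := by nlinarith [Nat.zero_le (a * R * D)]
  have hlayers : (m + 1) * (a * R * (R + 2)) + a * R * (d + 2) ≤ a * R * (R + d + 4) * (m + 3) := by
    nlinarith [Nat.zero_le (a * R * m * (d + 2)), Nat.zero_le (a * R * (R + d + 3))]
  linarith

/-- The constant in front of the approximation error. -/
def approxConst (d n : ℕ) : ℝ :=
  (5 ^ d * (2 * d) + 1) * (2 * d) ^ n
    + 2 ^ d * (d + 1) ^ n * (n * (d + 1) ^ n) * (2 * (d + n : ℕ) + 4 ^ (d + n))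

theorem approxConst_nonneg (d n : ℕ) : 0 ≤ approxConst d n := by
  rw [approxConst]
  positivity

theorem IsSmoothLimitOn.exists_net_boundedHolderOn_sub (hs0 : 0 ≤ s) (hs1 : s ≤ 1) {B : ℝ}
    (hB : 0 ≤ B) {S : Set (EuclideanSpace ℝ (Fin d))} {G : EuclideanSpace ℝ (Fin d) → Fin D → ℝ}
    (hG : ∀ j, IsSmoothLimitOn (n + 1) B S (fun θ => G θ j)) (hN : 0 < N)
    (hq : (d + (n + 1) : ℕ) ≤ q * (1 - s)) (hk : N ^ q ≤ 4 ^ k) :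
    ∃ net : ReLUNet D d,
      (∀ j, BoundedHolderOn s (approxConst d (n + 1) * B * (N ^ s / N ^ (n + 1))) S
        (fun θ => G θ j - net.toMap θ j)) ∧
      net.depth = (d + (n + 1)) * (2 * k + 3) + 3 ∧
      net.numWeights + net.numUnits ≤ layerSize d (n + 1) N * (D + net.depth) := by
  choose c hc hGc using fun j => (hG j).exists_boundedHolderOn_sub hs0 hs1 hB hN
  obtain ⟨net, hnet, hdepth, hsize⟩ := exists_net_eq_sum_netMonomial k N c
  refine ⟨net, fun j => ?_, hdepth, hsize⟩
  have hmon := (boundedHolderOn_sum_monomialError hN hs0 hs1 hq hk (hc j)).mono_set (hG j).1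
  refine (((hGc j).add hmon).mono (le_of_eq ?_)).congr fun θ _ => ?_
  · rw [approxConst, div_pow]
    ring
  · simp only [hnet, mul_sub, Finset.sum_sub_distrib]
    ring

end Approximation

/-! ### Network size in terms of the accuracy -/

section Accuracy

variable {d n : ℕ} {s ε : ℝ}

/-- The logarithmic factor `log (ε ^ (-n / (n - s)))` in the size bounds. -/
def logSize (n : ℕ) (s ε : ℝ) : ℝ := Real.log (ε ^ (-((n : ℝ) / (n - s))))

theorem logSize_eq (hε : 0 < ε) : logSize n s ε = (n : ℝ) / (n - s) * -Real.log ε := by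
  rw [logSize, Real.log_rpow hε]
  ring

theorem neg_log_le_logSize (hn : 1 ≤ n) (hs0 : 0 ≤ s) (hs1 : s < 1) (hε : 0 < ε) (hε1 : ε ≤ 1) :
    -Real.log ε ≤ logSize n s ε := by
  have hn' : (1 : ℝ) ≤ n := mod_cast hn
  rw [logSize_eq hε]
  refine le_mul_of_one_le_left (by linarith [Real.log_nonpos hε.le hε1]) ?_
  rw [one_le_div (by linarith)]
  linarith

theorem half_le_logSize (hn : 1 ≤ n) (hs0 : 0 ≤ s) (hs1 : s < 1) (hε : 0 < ε) (hε1 : ε < 1 / 2) :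
    1 / 2 ≤ logSize n s ε := by
  refine le_trans ?_ (neg_log_le_logSize hn hs0 hs1 hε (by linarith))
  have hlog := Real.log_lt_log hε hε1
  rw [one_div, Real.log_inv] at hlog
  linarith [Real.log_two_gt_d9]

theorem clog_two_le_log {N : ℕ} (hN : 0 < N) : (Nat.clog 2 N : ℝ) ≤ 2 * Real.log N + 1 := by
  obtain rfl | hN1 : N = 1 ∨ 1 < N := by omega
  · simp
  have hpow : (2 : ℝ) ^ (Nat.clog 2 N - 1) ≤ N :=
    mod_cast (Nat.pow_pred_clog_lt_self Nat.one_lt_two hN1).le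
  have hlog := Real.log_le_log (by positivity) hpow
  rw [Real.log_pow] at hlog
  have hpred : (Nat.clog 2 N : ℝ) ≤ (Nat.clog 2 N - 1 : ℕ) + 1 := by
    exact_mod_cast (by omega : Nat.clog 2 N ≤ Nat.clog 2 N - 1 + 1)
  nlinarith [Real.log_two_gt_d9, (Nat.clog 2 N - 1).cast_nonneg (α := ℝ)]

theorem exists_grid_size (hn : 1 ≤ n) (d : ℕ) (hs0 : 0 ≤ s) (hs1 : s < 1) (hε : 0 < ε)
    (hε1 : ε < 1 / 2) :
    ∃ N : ℕ, 0 < N ∧ (N : ℝ) ^ s / N ^ n ≤ ε ∧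
      ((N : ℝ) + 1) ^ d ≤ 4 ^ d * ε ^ (-((d : ℝ) / (n - s))) ∧
      (Nat.clog 2 N : ℝ) ≤ 8 * logSize n s ε := by
  have hn' : (1 : ℝ) ≤ n := mod_cast hn
  have hns : 0 < (n : ℝ) - s := by linarith
  set T : ℝ := ε ^ (-(1 / ((n : ℝ) - s))) with hT
  have hT1 : 1 ≤ T := Real.one_le_rpow_of_pos_of_le_one_of_nonpos hε (by linarith)
    (by rw [neg_nonpos]; positivity)
  have hT0 : 0 < T := by linarith
  have hle : T ≤ ⌈T⌉₊ := Nat.le_ceil T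
  have hlt : (⌈T⌉₊ : ℝ) < T + 1 := Nat.ceil_lt_add_one hT0.le
  have hN : 0 < ⌈T⌉₊ := Nat.ceil_pos.2 hT0
  refine ⟨⌈T⌉₊, hN, ?_, ?_, ?_⟩
  · rw [← Real.rpow_natCast, ← Real.rpow_sub (hT0.trans_le hle)]
    calc (⌈T⌉₊ : ℝ) ^ (s - n) ≤ T ^ (s - n) :=
          Real.rpow_le_rpow_of_nonpos hT0 hle (by linarith)
      _ = ε := by
          rw [hT, ← Real.rpow_mul hε.le, show -(1 / ((n : ℝ) - s)) * (s - n) = 1 by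
            field_simp; ring, Real.rpow_one]
  · have hTd : ε ^ (-((d : ℝ) / (n - s))) = T ^ d := by
      rw [hT, ← Real.rpow_natCast, ← Real.rpow_mul hε.le]
      congr 1
      ring
    rw [hTd, ← mul_pow]
    exact pow_le_pow_left₀ (by positivity) (by linarith) d
  · have hlogT : Real.log T ≤ logSize n s ε := by
      rw [hT, Real.log_rpow hε, logSize_eq hε, neg_mul_comm]
      refine mul_le_mul_of_nonneg_right (by gcongr) ?_
      linarith [Real.log_neg hε (by linarith)]
    have hlogN : Real.log ⌈T⌉₊ ≤ Real.log 2 + Real.log T := by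
      rw [← Real.log_mul two_ne_zero hT0.ne']
      exact Real.log_le_log (hT0.trans_le hle) (by linarith)
    linarith [clog_two_le_log hN, half_le_logSize hn hs0 hs1 hε hε1, Real.log_two_lt_d9]

theorem depth_le_mul_logSize (d q : ℕ) {k ℓ : ℝ} (hk : k ≤ 8 * ℓ) (hℓ : 1 / 2 ≤ ℓ) :
    d * (2 * (q * k) + 3) + 3 ≤ (d * (16 * q + 6) + 6) * ℓ := by
  have hq : q * k ≤ q * (8 * ℓ) := by gcongr
  have hd : d * (2 * (q * k) + 3) ≤ d * ((16 * q + 6) * ℓ) := by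
    gcongr
    linarith
  linarith

theorem layerSize_le {N : ℕ} {E : ℝ} (n : ℕ) (hN : ((N : ℝ) + 1) ^ d ≤ 4 ^ d * E) :
    (layerSize d n N : ℝ) ≤ layerSize d n 3 * E := by
  simp only [layerSize]
  push_cast
  calc _ ≤ 4 ^ d * E * (d + 1) ^ n * (Fintype.card (Reg (d + n))) *
        (Fintype.card (Reg (d + n)) + d + 4) := by gcongr
    _ = _ := by ring

/-- The constant in the depth bound for networks of Hölder order `s`. The products of `d + n`
factors that they compute need multiplications of accuracy `N ^ (-q)`, where `N` is the grid size
and `q` is the rounded quotient. -/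
def depthConst (d n : ℕ) (s : ℝ) : ℝ :=
  (d + n : ℕ) * (16 * (⌈((d + n : ℕ) : ℝ) / (1 - s)⌉₊ : ℝ) + 6) + 6

theorem one_le_depthConst (d n : ℕ) (s : ℝ) : 1 ≤ depthConst d n s := by
  rw [depthConst]
  linarith [(by positivity : (0 : ℝ) ≤
    (d + n : ℕ) * (16 * (⌈((d + n : ℕ) : ℝ) / (1 - s)⌉₊ : ℝ) + 6))]

theorem exists_net_accuracy [NeZero d] (hn : 1 ≤ n) (hs0 : 0 ≤ s) (hs1 : s < 1) {D : ℕ} {B : ℝ}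
    {S : Set (EuclideanSpace ℝ (Fin d))} {G : EuclideanSpace ℝ (Fin d) → Fin D → ℝ} (hB : 0 ≤ B)
    (hG : ∀ j, IsSmoothLimitOn n B S (fun θ => G θ j)) (hε : 0 < ε) (hε1 : ε < 1 / 2) :
    ∃ net : ReLUNet D d,
      (∀ j, BoundedHolderOn s (approxConst d n * B * ε) S (fun θ => G θ j - net.toMap θ j)) ∧
      (net.depth : ℝ) ≤ depthConst d n s * logSize n s ε ∧
      ((net.numWeights + net.numUnits : ℕ) : ℝ) ≤ depthConst d n s * layerSize d n 3 *
        (D + logSize n s ε) * ε ^ (-((d : ℝ) / (n - s))) := by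
  obtain ⟨N, hN, hNε, hNd, hclog⟩ := exists_grid_size hn d hs0 hs1 hε hε1
  obtain ⟨n, rfl⟩ := Nat.exists_eq_add_of_le' hn
  set q : ℕ := ⌈((d + (n + 1) : ℕ) : ℝ) / (1 - s)⌉₊ with hqdef
  have hq : ((d + (n + 1) : ℕ) : ℝ) ≤ q * (1 - s) :=
    (div_le_iff₀ (by linarith)).1 (Nat.le_ceil _)
  have hk : N ^ q ≤ 4 ^ (q * Nat.clog 2 N) := by
    calc N ^ q ≤ (4 ^ Nat.clog 2 N) ^ q := Nat.pow_le_pow_left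
          ((Nat.le_pow_clog Nat.one_lt_two N).trans (Nat.pow_le_pow_left (by norm_num) _)) q
      _ = 4 ^ (q * Nat.clog 2 N) := by rw [← pow_mul, mul_comm]
  obtain ⟨net, hnet, hdepth, hsize⟩ :=
    IsSmoothLimitOn.exists_net_boundedHolderOn_sub hs0 hs1.le hB hG hN hq hk
  have hdepth' : (net.depth : ℝ) ≤ depthConst d (n + 1) s * logSize (n + 1) s ε := by
    rw [hdepth, depthConst, ← hqdef]
    simpa using
      depth_le_mul_logSize (d + (n + 1)) q hclog (half_le_logSize hn hs0 hs1 hε hε1)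
  refine ⟨net, fun j => (hnet j).mono (mul_le_mul_of_nonneg_left hNε
    (mul_nonneg (approxConst_nonneg d (n + 1)) hB)), hdepth', ?_⟩
  set E : ℝ := ε ^ (-((d : ℝ) / ((n + 1 : ℕ) - s)))
  have : 0 < E := Real.rpow_pos_of_pos hε _
  have hD : (D : ℝ) ≤ depthConst d (n + 1) s * D :=
    le_mul_of_one_le_left (by positivity) (one_le_depthConst d (n + 1) s)
  calc ((net.numWeights + net.numUnits : ℕ) : ℝ)
      ≤ layerSize d (n + 1) N * (D + net.depth) := mod_cast hsize
    _ ≤ layerSize d (n + 1) 3 * E *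
        (depthConst d (n + 1) s * D + depthConst d (n + 1) s * logSize (n + 1) s ε) := by
        gcongr
        exact layerSize_le (n + 1) hNd
    _ = _ := by ring

end Accuracy

/-! ### Potentials -/

section QuadraticForm

variable {ι : Type*} [Fintype ι] {A : Matrix ι ι ℝ}

/-- The sum of the absolute values of the entries of `A`, which bounds the bilinear form of `A` on
vectors in the unit ball of the sup norm. -/
def entrySum (A : Matrix ι ι ℝ) : ℝ := ∑ i, ∑ j, |A i j|

theorem entrySum_nonneg (A : Matrix ι ι ℝ) : 0 ≤ entrySum A :=
  Finset.sum_nonneg fun _ _ => Finset.sum_nonneg fun _ _ => abs_nonneg _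

theorem dotProduct_mulVec_eq_sum (A : Matrix ι ι ℝ) (u v : ι → ℝ) :
    u ⬝ᵥ (A *ᵥ v) = ∑ i, ∑ j, A i j * (u i * v j) := by
  simp only [dotProduct, Matrix.mulVec, Finset.mul_sum]
  exact Finset.sum_congr rfl fun i _ => Finset.sum_congr rfl fun j _ => by ring

theorem dotProduct_mulVec_self_le (A : Matrix ι ι ℝ) {v : ι → ℝ} {e : ℝ} (hv : ∀ i, |v i| ≤ e) :
    v ⬝ᵥ (A *ᵥ v) ≤ entrySum A * e ^ 2 := by
  simp only [dotProduct_mulVec_eq_sum, entrySum, Finset.sum_mul]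
  refine Finset.sum_le_sum fun i _ => Finset.sum_le_sum fun j _ => (le_abs_self _).trans ?_
  have he : 0 ≤ e := (abs_nonneg _).trans (hv i)
  rw [abs_mul, abs_mul, sq]
  gcongr
  exacts [hv i, hv j]

theorem dotProduct_mulVec_self_sub (hA : A.IsSymm) (u v : ι → ℝ) :
    u ⬝ᵥ (A *ᵥ u) - v ⬝ᵥ (A *ᵥ v) = (u - v) ⬝ᵥ (A *ᵥ (u + v)) := by
  have hcomm : u ⬝ᵥ (A *ᵥ v) = v ⬝ᵥ (A *ᵥ u) := by
    rw [Matrix.dotProduct_mulVec, ← Matrix.mulVec_transpose, hA.eq, dotProduct_comm]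
  rw [Matrix.mulVec_add, sub_dotProduct, dotProduct_add, dotProduct_add, hcomm]
  ring

theorem dotProduct_mulVec_midpoint (A : Matrix ι ι ℝ) (y a b : ι → ℝ) :
    ((y - a) ⬝ᵥ (A *ᵥ (y - a)) + (y - b) ⬝ᵥ (A *ᵥ (y - b))) / 2
      = (y - midpoint ℝ a b) ⬝ᵥ (A *ᵥ (y - midpoint ℝ a b))
        + (a - b) ⬝ᵥ (A *ᵥ (a - b)) / 4 := by
  simp only [dotProduct_mulVec_eq_sum, Finset.sum_div, ← Finset.sum_add_distrib,
    midpoint_eq_smul_add]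
  refine Finset.sum_congr rfl fun i _ => Finset.sum_congr rfl fun j _ => ?_
  simp only [Pi.sub_apply, Pi.smul_apply, Pi.add_apply, smul_eq_mul, invOf_eq_inv]
  ring

theorem exists_pos_mul_sum_sq_le (hA : A.PosDef) :
    ∃ κ : ℝ, 0 < κ ∧ ∀ v : ι → ℝ, κ * ∑ i, v i ^ 2 ≤ v ⬝ᵥ (A *ᵥ v) := by
  have hpos : ∀ x ∈ Metric.sphere (0 : EuclideanSpace ℝ ι) 1, 0 < x.ofLp ⬝ᵥ (A *ᵥ x.ofLp) := by
    intro x hx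
    refine hA.dotProduct_mulVec_pos fun h => ?_
    have hx0 : x = 0 := by ext i; exact congrFun h i
    simp [hx0] at hx
  obtain ⟨κ, hκ, hmin⟩ := (isCompact_sphere (0 : EuclideanSpace ℝ ι) 1).exists_forall_le'
    (by fun_prop : Continuous fun x : EuclideanSpace ℝ ι => x.ofLp ⬝ᵥ (A *ᵥ x.ofLp)).continuousOn
    hpos
  refine ⟨κ, hκ, fun v => ?_⟩
  obtain rfl | hv := eq_or_ne v 0
  · simp
  have hnorm : 0 < ‖WithLp.toLp 2 v‖ := norm_pos_iff.2 (by simpa using hv)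
  have hle := hmin (‖WithLp.toLp 2 v‖⁻¹ • WithLp.toLp 2 v)
    (by simp [norm_smul, hnorm.ne'])
  simp only [WithLp.ofLp_smul, Matrix.mulVec_smul, smul_dotProduct, dotProduct_smul,
    smul_eq_mul] at hle
  rw [← mul_assoc, ← sq, inv_pow, ← div_eq_inv_mul, le_div_iff₀ (by positivity),
    EuclideanSpace.real_norm_sq_eq] at hle
  exact hle

theorem BoundedHolderOn.dotProduct_mulVec {X : Type*} [PseudoMetricSpace X] {s C C' : ℝ} {S : Set X}
    {u v : X → ι → ℝ} (A : Matrix ι ι ℝ) (hC : 0 ≤ C)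
    (hu : ∀ i, BoundedHolderOn s C S (fun x => u x i))
    (hv : ∀ i, BoundedHolderOn s C' S (fun x => v x i)) :
    BoundedHolderOn s (entrySum A * (2 * C * C')) S (fun x => u x ⬝ᵥ (A *ᵥ v x)) := by
  simp only [dotProduct_mulVec_eq_sum, entrySum, Finset.sum_mul]
  exact .sum _ fun i => .sum _ fun j => ((hu i).mul hC (hv j)).const_mul (A i j)

end QuadraticForm

section Potential

variable {d D : ℕ} {Γ : Matrix (Fin D) (Fin D) ℝ} {s M b e : ℝ}
  {G G' : EuclideanSpace ℝ (Fin d) → Fin D → ℝ} {S : Set (EuclideanSpace ℝ (Fin d))}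

theorem potential_sub_eq (hΓ : Γ⁻¹.IsSymm) (y : Fin D → ℝ) (θ : EuclideanSpace ℝ (Fin d)) :
    potential Γ G y θ - potential Γ G' y θ
      = -(1 / 2) * ((G θ - G' θ) ⬝ᵥ (Γ⁻¹ *ᵥ (2 • y - 2 • G θ + (G θ - G' θ)))) := by
  rw [potential, potential, ← mul_sub, dotProduct_mulVec_self_sub hΓ,
    show y - G θ - (y - G' θ) = -(G θ - G' θ) by abel,
    show y - G θ + (y - G' θ) = 2 • y - 2 • G θ + (G θ - G' θ) by abel, neg_dotProduct]
  ring

theorem BoundedHolderOn.potential_sub (hΓ : Γ⁻¹.IsSymm) (he : 0 ≤ e)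
    (hG : ∀ j, BoundedHolderOn s b S (fun θ => G θ j))
    (hG' : ∀ j, BoundedHolderOn s e S (fun θ => G θ j - G' θ j)) {y : Fin D → ℝ} (hy : ‖y‖ ≤ M) :
    BoundedHolderOn s (entrySum Γ⁻¹ * (2 * M + 2 * b + e) * e) S
      (fun θ => potential Γ G y θ - potential Γ G' y θ) := by
  have hsum : ∀ j, BoundedHolderOn s (2 * M + 2 * b + e) S
      (fun θ => (2 • y - 2 • G θ + (G θ - G' θ)) j) := fun j => by
    have hyj : |2 * y j| ≤ 2 * M := by
      rw [abs_mul, abs_two]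
      exact mul_le_mul_of_nonneg_left ((norm_le_pi_norm y j).trans hy) zero_le_two
    simpa using (((BoundedHolderOn.const (2 * y j)).mono hyj).sub ((hG j).const_mul 2)).add (hG' j)
  simp only [potential_sub_eq hΓ]
  convert (BoundedHolderOn.dotProduct_mulVec (u := fun θ => G θ - G' θ) Γ⁻¹ he hG' hsum).const_mul
    (-(1 / 2)) using 1
  rw [abs_neg, abs_of_pos one_half_pos]
  ring

theorem BoundedHolderOn.slobodeckijNormTop_le {C : ℝ} {f : EuclideanSpace ℝ (Fin d) → ℝ}
    (h : BoundedHolderOn s C S f) (hS : ∀ᵐ x ∂cubeMeasure d, x ∈ S) :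
    slobodeckijNormTop s f ≤ ENNReal.ofReal C := by
  have hbound : eLpNorm f ∞ (cubeMeasure d) ≤ ENNReal.ofReal C := by
    rw [eLpNorm_exponent_top]
    exact eLpNormEssSup_le_of_ae_bound (hS.mono fun x hx => h.bound x hx)
  rw [slobodeckijNormTop]
  split_ifs
  · exact hbound
  · refine max_le hbound ?_
    rw [eLpNorm_exponent_top]
    refine eLpNormEssSup_le_of_ae_bound ?_
    filter_upwards [Measure.quasiMeasurePreserving_fst.ae hS,
      Measure.quasiMeasurePreserving_snd.ae hS] with z hz₁ hz₂
    rw [Real.norm_eq_abs, abs_div, abs_of_nonneg (by positivity : 0 ≤ ‖z.1 - z.2‖ ^ s),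
      ← dist_eq_norm]
    exact div_le_of_le_mul₀ (by positivity) ((abs_nonneg _).trans (h.bound _ hz₁))
      (h.holder _ hz₁ _ hz₂)

end Potential

/-! ### The Hellinger distance of Gaussian likelihoods -/

section Hellinger

theorem hellingerDist_eq {Y : Type*} [MeasurableSpace Y] {μ : Measure Y} {p q : Y → ℝ}
    (hp0 : 0 ≤ p) (hq0 : 0 ≤ q) (hp : Integrable p μ) (hq : Integrable q μ)
    (hp1 : ∫ y, p y ∂μ = 1) (hq1 : ∫ y, q y ∂μ = 1) :
    hellingerDist μ p q = ENNReal.ofReal √(1 - ∫ y, √(p y) * √(q y) ∂μ) := by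
  have hsq : ∀ y, (√(p y) - √(q y)) ^ 2 = p y + q y - 2 * (√(p y) * √(q y)) := fun y => by
    rw [sub_sq, Real.sq_sqrt (hp0 y), Real.sq_sqrt (hq0 y)]
    ring
  have hpq0 : ∀ y, 0 ≤ √(p y) * √(q y) := fun y => by positivity
  have hadd : Integrable (fun y => p y + q y) μ := hp.add hq
  have hpq : Integrable (fun y => √(p y) * √(q y)) μ := by
    refine hadd.mono' ((Real.continuous_sqrt.comp_aestronglyMeasurable hp.1).mul
      (Real.continuous_sqrt.comp_aestronglyMeasurable hq.1)) (.of_forall fun y => ?_)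
    rw [Real.norm_of_nonneg (hpq0 y)]
    linarith [hsq y, sq_nonneg (√(p y) - √(q y)), hpq0 y]
  have hint : ∫ y, (√(p y) - √(q y)) ^ 2 ∂μ = 2 * (1 - ∫ y, √(p y) * √(q y) ∂μ) := by
    simp only [hsq]
    rw [integral_sub hadd (hpq.const_mul 2), integral_add hp hq, hp1, hq1, integral_const_mul]
    ring
  have hint0 : 0 ≤ ∫ y, (√(p y) - √(q y)) ^ 2 ∂μ := integral_nonneg fun y => sq_nonneg _
  rw [hellingerDist, ← ofReal_integral_eq_lintegral_ofReal
    (by simp only [hsq]; exact hadd.sub (hpq.const_mul 2))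
    (.of_forall fun y => sq_nonneg _), hint, ENNReal.ofReal_mul zero_le_two,
    ENNReal.ofReal_ofNat, ENNReal.inv_mul_cancel_left two_ne_zero ENNReal.ofNat_ne_top,
    ENNReal.ofReal_rpow_of_nonneg (by linarith) one_half_pos.le, Real.sqrt_eq_rpow]

variable {ι : Type*} [Fintype ι] {A : Matrix ι ι ℝ}

/-- The unnormalised centred Gaussian density with precision matrix `A`. -/
def gaussianWeight (A : Matrix ι ι ℝ) (v : ι → ℝ) : ℝ := Real.exp (-(1 / 2 * (v ⬝ᵥ (A *ᵥ v))))

/-- The density of the Gaussian measure with mean `a` and precision matrix `A`. -/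
def gaussianDensity (A : Matrix ι ι ℝ) (a y : ι → ℝ) : ℝ :=
  gaussianWeight A (y - a) / ∫ v, gaussianWeight A v

theorem integrable_gaussianWeight (hA : A.PosDef) : Integrable (gaussianWeight A) := by
  obtain ⟨κ, hκ, hle⟩ := exists_pos_mul_sum_sq_le hA
  have hprod : Integrable fun v : ι → ℝ => ∏ i, Real.exp (-(κ / 2) * v i ^ 2) :=
    Integrable.fintype_prod fun _ => integrable_exp_neg_mul_sq (by positivity)
  have hcont : Continuous (gaussianWeight A) := by
    unfold gaussianWeight
    fun_prop
  refine hprod.mono' hcont.aestronglyMeasurable (.of_forall fun v => ?_)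
  rw [gaussianWeight, Real.norm_of_nonneg (Real.exp_pos _).le, ← Real.exp_sum, Real.exp_le_exp,
    ← Finset.mul_sum]
  linarith [hle v]

theorem integral_gaussianWeight_pos (hA : A.PosDef) : 0 < ∫ v, gaussianWeight A v :=
  integral_exp_pos (integrable_gaussianWeight hA)

theorem gaussianDensity_nonneg (hA : A.PosDef) (a : ι → ℝ) : 0 ≤ gaussianDensity A a :=
  fun _ => div_nonneg (Real.exp_pos _).le (integral_gaussianWeight_pos hA).le

theorem integrable_gaussianDensity (hA : A.PosDef) (a : ι → ℝ) :
    Integrable (gaussianDensity A a) :=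
  ((integrable_gaussianWeight hA).comp_sub_right a).div_const _

theorem integral_gaussianDensity (hA : A.PosDef) (a : ι → ℝ) :
    ∫ y, gaussianDensity A a y = 1 := by
  simp only [gaussianDensity]
  rw [integral_div, integral_sub_right_eq_self (gaussianWeight A),
    div_self (integral_gaussianWeight_pos hA).ne']

theorem gaussianWeight_sub_mul (A : Matrix ι ι ℝ) (a b y : ι → ℝ) :
    gaussianWeight A (y - a) * gaussianWeight A (y - b)
      = (Real.exp (-((a - b) ⬝ᵥ (A *ᵥ (a - b)) / 8))
        * gaussianWeight A (y - midpoint ℝ a b)) ^ 2 := by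
  simp only [gaussianWeight, ← Real.exp_add, ← Real.exp_nat_mul]
  congr 1
  push_cast
  linarith [dotProduct_mulVec_midpoint A y a b]

theorem sqrt_gaussianDensity_mul (hA : A.PosDef) (a b y : ι → ℝ) :
    √(gaussianDensity A a y) * √(gaussianDensity A b y)
      = Real.exp (-((a - b) ⬝ᵥ (A *ᵥ (a - b)) / 8)) * gaussianDensity A (midpoint ℝ a b) y := by
  rw [← Real.sqrt_mul (gaussianDensity_nonneg hA a y), gaussianDensity, gaussianDensity,
    div_mul_div_comm, gaussianWeight_sub_mul, ← sq, ← div_pow, mul_div_assoc]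
  exact Real.sqrt_sq (mul_nonneg (Real.exp_pos _).le (gaussianDensity_nonneg hA _ y))

theorem hellingerDist_gaussianDensity (hA : A.PosDef) (a b : ι → ℝ) :
    hellingerDist volume (gaussianDensity A a) (gaussianDensity A b)
      = ENNReal.ofReal √(1 - Real.exp (-((a - b) ⬝ᵥ (A *ᵥ (a - b)) / 8))) := by
  rw [hellingerDist_eq (gaussianDensity_nonneg hA a) (gaussianDensity_nonneg hA b)
    (integrable_gaussianDensity hA a) (integrable_gaussianDensity hA b)
    (integral_gaussianDensity hA a) (integral_gaussianDensity hA b)]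
  simp only [sqrt_gaussianDensity_mul hA]
  rw [integral_const_mul, integral_gaussianDensity hA, mul_one]

theorem hellingerDist_gaussianDensity_le (hA : A.PosDef) {a b : ι → ℝ} {e : ℝ} (he : 0 ≤ e)
    (hab : ∀ i, |a i - b i| ≤ e) :
    hellingerDist volume (gaussianDensity A a) (gaussianDensity A b)
      ≤ ENNReal.ofReal ((1 + entrySum A) * e) := by
  have hsum := entrySum_nonneg A
  rw [hellingerDist_gaussianDensity hA]
  refine ENNReal.ofReal_le_ofReal (Real.sqrt_le_iff.2 ⟨by positivity, ?_⟩)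
  calc 1 - Real.exp (-((a - b) ⬝ᵥ (A *ᵥ (a - b)) / 8))
      ≤ (a - b) ⬝ᵥ (A *ᵥ (a - b)) / 8 := by
        linarith [Real.add_one_le_exp (-((a - b) ⬝ᵥ (A *ᵥ (a - b)) / 8))]
    _ ≤ entrySum A * e ^ 2 / 8 := by
        gcongr
        exact dotProduct_mulVec_self_le A hab
    _ ≤ ((1 + entrySum A) * e) ^ 2 := by
        rw [mul_pow, mul_div_right_comm]
        gcongr
        nlinarith

theorem likelihood_eq_gaussianDensity {d D : ℕ} (Γ : Matrix (Fin D) (Fin D) ℝ)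
    (G : EuclideanSpace ℝ (Fin d) → Fin D → ℝ) (θ : EuclideanSpace ℝ (Fin d)) :
    likelihood Γ G θ = gaussianDensity Γ⁻¹ (G θ) := by
  funext y
  rw [gaussianDensity, ← integral_sub_right_eq_self (gaussianWeight Γ⁻¹) (G θ)]
  rfl

end Hellinger

/-! ### Emulators of a forward map -/

section Emulator

variable {d n D : ℕ} {s ε B : ℝ}

/-- The size constant of the emulators; it must not depend on the number of outputs. -/
def sizeConst (d n : ℕ) (s : ℝ) : ℝ := 4 * (depthConst d n s * (1 + layerSize d n 3))

theorem depthConst_le_sizeConst (d n : ℕ) (s : ℝ) : 4 * depthConst d n s ≤ sizeConst d n s := by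
  rw [sizeConst]
  gcongr
  exact le_mul_of_one_le_right (by linarith [one_le_depthConst d n s]) (by simp)

theorem sizeConst_pos (d n : ℕ) (s : ℝ) : 0 < sizeConst d n s := by
  linarith [depthConst_le_sizeConst d n s, one_le_depthConst d n s]

theorem toMap_zero (θ : EuclideanSpace ℝ (Fin d)) :
    (ReLUNet.output (0 : Matrix (Fin D) (Fin d) ℝ) 0).toMap θ = 0 := by
  simp [ReLUNet.toMap, ReLUNet.eval]

theorem sizeBound_zero (hn : 1 ≤ n) (hs0 : 0 ≤ s) (hs1 : s < 1) (hε : 0 < ε) (hε1 : ε < 1 / 2) :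
    (ReLUNet.output (0 : Matrix (Fin D) (Fin d) ℝ) 0).SizeBound n s (sizeConst d n s) ε := by
  have hc := sizeConst_pos d n s
  refine ⟨?_, ?_⟩
  · change ((1 : ℕ) : ℝ) ≤ _ * logSize n s ε
    have := half_le_logSize hn hs0 hs1 hε hε1
    rw [Nat.cast_one]
    nlinarith [depthConst_le_sizeConst d n s, one_le_depthConst d n s]
  · simp only [ReLUNet.numWeights, ReLUNet.numUnits, ReLUNet.layerWeights, Matrix.zero_apply,
      Pi.zero_apply, ne_eq, not_true_eq_false, ofPred_false, ncard_empty, add_zero, Nat.cast_zero]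
    positivity

theorem sizeBound_of_le_logSize {net : ReLUNet D d} (hn : 1 ≤ n) (hs0 : 0 ≤ s) (hs1 : s < 1)
    (hε : 0 < ε) (hε1 : ε < 1 / 2) (hD : (D : ℝ) ≤ logSize n s ε)
    (hdepth : (net.depth : ℝ) ≤ depthConst d n s * logSize n s ε)
    (hsize : ((net.numWeights + net.numUnits : ℕ) : ℝ) ≤ depthConst d n s * layerSize d n 3 *
      (D + logSize n s ε) * ε ^ (-((d : ℝ) / (n - s)))) :
    net.SizeBound n s (sizeConst d n s) ε := by
  have hc := one_le_depthConst d n s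
  have hℓ := half_le_logSize hn hs0 hs1 hε hε1
  refine ⟨hdepth.trans ?_, hsize.trans ?_⟩
  · change _ ≤ _ * logSize n s ε
    gcongr
    linarith [depthConst_le_sizeConst d n s]
  · change _ ≤ _ * _ * logSize n s ε ^ 2
    set ℓ := logSize n s ε
    set E : ℝ := ε ^ (-((d : ℝ) / (n - s)))
    have : 0 < E := Real.rpow_pos_of_pos hε _
    have hsum : D + ℓ ≤ 4 * ℓ ^ 2 := by nlinarith
    calc depthConst d n s * layerSize d n 3 * (D + ℓ) * E
        ≤ depthConst d n s * (1 + layerSize d n 3) * (4 * ℓ ^ 2) * E := by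
          gcongr
          linarith
      _ = sizeConst d n s * E * ℓ ^ 2 := by
          rw [sizeConst]
          ring

theorem one_le_exp_mul_of_logSize_lt (hn : 1 ≤ n) (hs0 : 0 ≤ s) (hs1 : s < 1) (hε : 0 < ε)
    (hε1 : ε ≤ 1) {t : ℝ} (ht : logSize n s ε < t) : 1 ≤ Real.exp t * ε := by
  rw [← Real.exp_log hε, ← Real.exp_add, Real.one_le_exp_iff]
  linarith [neg_log_le_logSize hn hs0 hs1 hε hε1]

/-- The constant in the error bound for emulators of a forward map with `D` components. -/
def emulatorConst (d n D : ℕ) (B : ℝ) : ℝ := approxConst d n * B + (d + 2) * B * Real.exp D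

theorem emulatorConst_nonneg (d n D : ℕ) (hB : 0 ≤ B) : 0 ≤ emulatorConst d n D B := by
  have := approxConst_nonneg d n
  rw [emulatorConst]
  positivity

/-- If the number `D` of outputs exceeds `logSize`, the required accuracy is at least `exp (-D)` and
the zero network attains it up to a constant, so that `D` does not enter the size bound. -/
theorem exists_emulator [NeZero d] (hn : 1 ≤ n) (hs0 : 0 ≤ s) (hs1 : s < 1)
    {S : Set (EuclideanSpace ℝ (Fin d))} {G : EuclideanSpace ℝ (Fin d) → Fin D → ℝ} (hB : 0 ≤ B)
    (hG : ∀ j, IsSmoothLimitOn n B S (fun θ => G θ j)) (hε : 0 < ε) (hε1 : ε < 1 / 2) :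
    ∃ net : ReLUNet D d, net.SizeBound n s (sizeConst d n s) ε ∧
      ∀ j, BoundedHolderOn s (emulatorConst d n D B * ε) S (fun θ => G θ j - net.toMap θ j) := by
  obtain hD | hD := le_or_gt (D : ℝ) (logSize n s ε)
  · obtain ⟨net, hnet, hdepth, hsize⟩ := exists_net_accuracy hn hs0 hs1 hB hG hε hε1
    refine ⟨net, sizeBound_of_le_logSize hn hs0 hs1 hε hε1 hD hdepth hsize,
      fun j => (hnet j).mono ?_⟩
    gcongr
    exact le_add_of_nonneg_right (by positivity)
  · refine ⟨.output 0 0, sizeBound_zero hn hs0 hs1 hε hε1, fun j => ?_⟩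
    obtain ⟨n, rfl⟩ := Nat.exists_eq_add_of_le' hn
    simp only [toMap_zero, Pi.zero_apply, sub_zero]
    refine ((hG j).boundedHolderOn hs0 hs1.le hB).mono ?_
    calc (d + 2) * B ≤ (d + 2) * B * (Real.exp D * ε) := le_mul_of_one_le_right (by positivity)
          (one_le_exp_mul_of_logSize_lt hn hs0 hs1 hε (by linarith) hD)
      _ = (d + 2) * B * Real.exp D * ε := by ring
      _ ≤ emulatorConst d (n + 1) D B * ε := by
          gcongr
          exact le_add_of_nonneg_left (mul_nonneg (approxConst_nonneg d (n + 1)) hB)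

theorem logSize_div_le (hn : 1 ≤ n) (hs0 : 0 ≤ s) (hs1 : s < 1) (hε : 0 < ε) (hε1 : ε < 1 / 2)
    {C : ℝ} (hC : 1 ≤ C) :
    logSize n s (ε / C) ≤ (1 + 2 * ((n : ℝ) / (n - s) * Real.log C)) * logSize n s ε := by
  have hn' : (1 : ℝ) ≤ n := mod_cast hn
  have hns : 0 < (n : ℝ) - s := by linarith
  have hlog : 0 ≤ (n : ℝ) / (n - s) * Real.log C :=
    mul_nonneg (by positivity) (Real.log_nonneg hC)
  have hsplit : logSize n s (ε / C) = logSize n s ε + (n : ℝ) / (n - s) * Real.log C := by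
    rw [logSize_eq (by positivity), logSize_eq hε, Real.log_div hε.ne' (by positivity)]
    ring
  rw [hsplit]
  nlinarith [half_le_logSize hn hs0 hs1 hε hε1]

/-- The factor by which the size constant grows when the accuracy is improved by the factor `C`. -/
def refineConst (d n : ℕ) (s C : ℝ) : ℝ :=
  (1 + 2 * ((n : ℝ) / (n - s) * Real.log C)) ^ 2 * C ^ ((d : ℝ) / (n - s))

theorem refineConst_pos (hn : 1 ≤ n) (hs1 : s < 1) (d : ℕ) {C : ℝ} (hC : 1 ≤ C) :
    0 < refineConst d n s C := by
  have hn' : (1 : ℝ) ≤ n := mod_cast hn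
  have hns : 0 < (n : ℝ) - s := by linarith
  have := Real.log_nonneg hC
  rw [refineConst]
  positivity

theorem ReLUNet.SizeBound.of_div {net : ReLUNet D d} (hn : 1 ≤ n) (hs0 : 0 ≤ s) (hs1 : s < 1)
    (hε : 0 < ε) (hε1 : ε < 1 / 2) {c C : ℝ} (hc : 0 ≤ c) (hC : 1 ≤ C)
    (h : net.SizeBound n s c (ε / C)) : net.SizeBound n s (c * refineConst d n s C) ε := by
  have hn' : (1 : ℝ) ≤ n := mod_cast hn
  have hns : 0 < (n : ℝ) - s := by linarith
  have hlog := logSize_div_le hn hs0 hs1 hε hε1 hC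
  have hℓ := half_le_logSize hn hs0 hs1 hε hε1
  have hℓC := half_le_logSize hn hs0 hs1 (by positivity : 0 < ε / C)
    ((div_le_self hε.le hC).trans_lt hε1)
  set P : ℝ := 1 + 2 * ((n : ℝ) / (n - s) * Real.log C)
  have hP : 1 ≤ P := le_add_of_nonneg_right (by have := Real.log_nonneg hC; positivity)
  set q : ℝ := C ^ ((d : ℝ) / (n - s))
  have hq : 1 ≤ q := Real.one_le_rpow hC (by positivity)
  refine ⟨h.1.trans ?_, h.2.trans ?_⟩
  · change c * logSize n s (ε / C) ≤ c * (P ^ 2 * q) * logSize n s ε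
    calc c * logSize n s (ε / C) ≤ c * (P * logSize n s ε) := by gcongr
      _ ≤ c * (P ^ 2 * q * logSize n s ε) := by
          gcongr
          nlinarith
      _ = c * (P ^ 2 * q) * logSize n s ε := by ring
  · change c * _ * logSize n s (ε / C) ^ 2 ≤ c * (P ^ 2 * q) * _ * logSize n s ε ^ 2
    have hpow : (ε / C) ^ (-((d : ℝ) / (n - s))) = q * ε ^ (-((d : ℝ) / (n - s))) := by
      rw [Real.div_rpow hε.le (by positivity), Real.rpow_neg (x := C) (by positivity),
        div_inv_eq_mul, mul_comm]
    rw [hpow]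
    calc c * (q * ε ^ (-((d : ℝ) / (n - s)))) * logSize n s (ε / C) ^ 2
        ≤ c * (q * ε ^ (-((d : ℝ) / (n - s)))) * (P * logSize n s ε) ^ 2 := by gcongr
      _ = _ := by ring

end Emulator

/-! ### Errors of potentials and likelihoods -/

section Bayes

variable {d n D : ℕ} {Γ : Matrix (Fin D) (Fin D) ℝ} {s M B δ ε : ℝ}
  {G G' : EuclideanSpace ℝ (Fin d) → Fin D → ℝ} {S : Set (EuclideanSpace ℝ (Fin d))}

/-- The potentials of `G` and `G'` differ by at most `δ` in the Slobodeckij norm, uniformly over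
data `y` of size `M`, and their likelihoods by at most `δ` in the Hellinger distance. -/
def BayesErrorLE (Γ : Matrix (Fin D) (Fin D) ℝ) (s M : ℝ)
    (G G' : EuclideanSpace ℝ (Fin d) → Fin D → ℝ) (δ : ℝ) : Prop :=
  (∀ y : Fin D → ℝ, ‖y‖ ≤ M →
    slobodeckijNormTop s (fun θ => potential Γ G y θ - potential Γ G' y θ) ≤ ENNReal.ofReal δ) ∧
  ∀ᵐ θ ∂cubeMeasure d, hellingerDist volume (likelihood Γ G θ) (likelihood Γ G' θ)
    ≤ ENNReal.ofReal δ

/-- The constant by which an error `A * ε` of a forward map bounded by `b` enters potentials and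
likelihoods; the summand `1` makes it at least one. -/
def errorConst (Γ : Matrix (Fin D) (Fin D) ℝ) (M b A : ℝ) : ℝ :=
  entrySum Γ⁻¹ * (2 * |M| + 2 * b + A) * A + (1 + entrySum Γ⁻¹) * A + 1

theorem one_le_errorConst (Γ : Matrix (Fin D) (Fin D) ℝ) (M : ℝ) {b A : ℝ} (hb : 0 ≤ b)
    (hA : 0 ≤ A) : 1 ≤ errorConst Γ M b A := by
  have := entrySum_nonneg Γ⁻¹
  exact le_add_of_nonneg_left (by positivity)

theorem bayesErrorLE_of_boundedHolderOn (hΓ : Γ.PosDef) (M : ℝ) {b A : ℝ} (hb : 0 ≤ b) (hA : 0 ≤ A)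
    (hε : 0 ≤ ε) (hε1 : ε ≤ 1) (hS : ∀ᵐ x ∂cubeMeasure d, x ∈ S)
    (hG : ∀ j, BoundedHolderOn s b S (fun θ => G θ j))
    (hG' : ∀ j, BoundedHolderOn s (A * ε) S (fun θ => G θ j - G' θ j)) :
    BayesErrorLE Γ s M G G' (errorConst Γ M b A * ε) := by
  have hsymm : Γ⁻¹.IsSymm :=
    (Matrix.conjTranspose_eq_transpose_of_trivial Γ⁻¹).symm.trans hΓ.inv.isHermitian
  have hg := entrySum_nonneg Γ⁻¹
  have hAε : A * ε ≤ A := mul_le_of_le_one_right hA hε1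
  have hpot : 0 ≤ entrySum Γ⁻¹ * (2 * |M| + 2 * b + A) * (A * ε) := by positivity
  have hhel : 0 ≤ (1 + entrySum Γ⁻¹) * (A * ε) := by positivity
  have hconst : errorConst Γ M b A * ε = entrySum Γ⁻¹ * (2 * |M| + 2 * b + A) * (A * ε)
      + (1 + entrySum Γ⁻¹) * (A * ε) + ε := by
    rw [errorConst]
    ring
  refine ⟨fun y hy => ((BoundedHolderOn.potential_sub hsymm (by positivity) hG hG'
    (hy.trans (le_abs_self M))).mono ?_).slobodeckijNormTop_le hS, ?_⟩
  · calc entrySum Γ⁻¹ * (2 * |M| + 2 * b + A * ε) * (A * ε)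
        ≤ entrySum Γ⁻¹ * (2 * |M| + 2 * b + A) * (A * ε) := by gcongr
      _ ≤ errorConst Γ M b A * ε := by linarith
  · filter_upwards [hS] with θ hθ
    rw [likelihood_eq_gaussianDensity, likelihood_eq_gaussianDensity]
    refine (hellingerDist_gaussianDensity_le hΓ.inv (by positivity) fun j =>
      (hG' j).bound θ hθ).trans (ENNReal.ofReal_le_ofReal ?_)
    linarith

theorem exists_forall_isSmoothLimitOn
    (hG : ∀ j, Integrable (fun θ => G θ j) (cubeMeasure d))
    (hnorm : ∀ j, sobolevNormTop n (fun θ => G θ j) < ENNReal.ofReal B) :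
    ∃ S, (∀ᵐ x ∂cubeMeasure d, x ∈ S) ∧ ∀ j, IsSmoothLimitOn n B S (fun θ => G θ j) := by
  choose S hS hlim using fun j => exists_isSmoothLimitOn (hG j) (hnorm j)
  refine ⟨cube d ∩ ⋂ j, S j, ?_, fun j => ⟨inter_subset_left, ?_⟩⟩
  · filter_upwards [ae_restrict_mem (measurableSet_cube d), ae_all_iff.2 hS] with x hx hxS
    exact ⟨hx, mem_iInter.2 hxS⟩
  · obtain ⟨-, g, hg, hgB, hglim⟩ := hlim j
    exact ⟨g, hg, hgB, fun x hx => hglim x (mem_iInter.1 hx.2 j)⟩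

/-- The constant in the error bounds for potentials and likelihoods. -/
def bayesConst (d n : ℕ) (Γ : Matrix (Fin D) (Fin D) ℝ) (M B : ℝ) : ℝ :=
  errorConst Γ M ((d + 2) * (|B| + 1)) (emulatorConst d n D (|B| + 1))

theorem one_le_bayesConst (d n : ℕ) (Γ : Matrix (Fin D) (Fin D) ℝ) (M B : ℝ) :
    1 ≤ bayesConst d n Γ M B :=
  one_le_errorConst Γ M (by positivity) (emulatorConst_nonneg d n D (by positivity))

theorem exists_emulator_bayesErrorLE (hd : 1 ≤ d) (hn : 1 ≤ n) (hs0 : 0 ≤ s) (hs1 : s < 1)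
    (hΓ : Γ.PosDef) (M : ℝ) (hG : ∀ j, Integrable (fun θ => G θ j) (cubeMeasure d))
    (hnorm : ∀ j, sobolevNormTop n (fun θ => G θ j) ≤ ENNReal.ofReal B) (hε : 0 < ε)
    (hε1 : ε < 1 / 2) :
    ∃ net : ReLUNet D d, net.SizeBound n s (sizeConst d n s) ε ∧
      BayesErrorLE Γ s M G net.toMap (bayesConst d n Γ M B * ε) := by
  have : NeZero d := ⟨by omega⟩
  have hB : ENNReal.ofReal B < ENNReal.ofReal (|B| + 1) :=
    (ENNReal.ofReal_lt_ofReal_iff (by positivity)).2 (lt_add_of_le_of_pos (le_abs_self B) one_pos)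
  have hB0 : 0 ≤ |B| + 1 := by positivity
  obtain ⟨S, hS, hlim⟩ := exists_forall_isSmoothLimitOn hG fun j => (hnorm j).trans_lt hB
  obtain ⟨net, hsize, hnet⟩ := exists_emulator hn hs0 hs1 hB0 hlim hε hε1
  obtain ⟨n, rfl⟩ := Nat.exists_eq_add_of_le' hn
  exact ⟨net, hsize, bayesErrorLE_of_boundedHolderOn hΓ M (by positivity)
    (emulatorConst_nonneg d (n + 1) D hB0) hε.le (by linarith) hS
    (fun j => (hlim j).boundedHolderOn hs0 hs1.le hB0) hnet⟩

end Bayes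

end

end FBNN

theorem theorem2 (d n : ℕ) (hd : 1 ≤ d) (hn : 1 ≤ n) (s : ℝ) (hs0 : 0 ≤ s) (hs1 : s < 1) :
    ∃ c : ℝ, 0 < c ∧
      ∀ (D : ℕ) (Γ : Matrix (Fin D) (Fin D) ℝ), Γ.PosDef → ∀ (M B : ℝ),
        ∃ C c' : ℝ, 0 < C ∧ 0 < c' ∧
          ∀ (G : EuclideanSpace ℝ (Fin d) → Fin D → ℝ),
            (∀ j, FBNN.MemSobolev n ∞ (fun θ => G θ j)) →
            (∀ j, FBNN.sobolevNormTop n (fun θ => G θ j) ≤ ENNReal.ofReal B) →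
            ∀ ε : ℝ, 0 < ε → ε < 1 / 2 →
              (∃ Ge : FBNN.ReLUNet D d, Ge.SizeBound n s c ε ∧
                (∀ y : Fin D → ℝ, ‖y‖ ≤ M →
                  FBNN.slobodeckijNormTop s (fun θ => FBNN.potential Γ G y θ
                    - FBNN.potential Γ Ge.toMap y θ) ≤ ENNReal.ofReal (C * ε)) ∧
                ∀ᵐ θ ∂FBNN.cubeMeasure d, FBNN.hellingerDist volume
                  (FBNN.likelihood Γ G θ) (FBNN.likelihood Γ Ge.toMap θ)
                    ≤ ENNReal.ofReal (C * ε)) ∧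
              (∃ Ge : FBNN.ReLUNet D d, Ge.SizeBound n s c' ε ∧
                (∀ y : Fin D → ℝ, ‖y‖ ≤ M →
                  FBNN.slobodeckijNormTop s (fun θ => FBNN.potential Γ G y θ
                    - FBNN.potential Γ Ge.toMap y θ) ≤ ENNReal.ofReal ε) ∧
                ∀ᵐ θ ∂FBNN.cubeMeasure d, FBNN.hellingerDist volume
                  (FBNN.likelihood Γ G θ) (FBNN.likelihood Γ Ge.toMap θ)
                    ≤ ENNReal.ofReal (C * ε)) := by
  refine ⟨FBNN.sizeConst d n s, FBNN.sizeConst_pos d n s, fun D Γ hΓ M B => ?_⟩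
  have hC : 1 ≤ FBNN.bayesConst d n Γ M B := FBNN.one_le_bayesConst d n Γ M B
  set C := FBNN.bayesConst d n Γ M B
  refine ⟨C, FBNN.sizeConst d n s * FBNN.refineConst d n s C, by positivity,
    mul_pos (FBNN.sizeConst_pos d n s) (FBNN.refineConst_pos hn hs1 d hC), ?_⟩
  intro G hG hnorm ε hε hε1
  have hemulator : ∀ δ : ℝ, 0 < δ → δ < 1 / 2 → ∃ Ge : FBNN.ReLUNet D d,
      Ge.SizeBound n s (FBNN.sizeConst d n s) δ ∧ FBNN.BayesErrorLE Γ s M G Ge.toMap (C * δ) :=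
    fun δ hδ hδ1 => FBNN.exists_emulator_bayesErrorLE hd hn hs0 hs1 hΓ M
      (fun j => (hG j).1.integrable le_top) hnorm hδ hδ1
  refine ⟨hemulator ε hε hε1, ?_⟩
  obtain ⟨Ge, hsize, hpot, hhel⟩ := hemulator (ε / C) (by positivity)
    ((div_le_self hε.le hC).trans_lt hε1)
  rw [mul_div_cancel₀ ε (by positivity)] at hpot hhel
  exact ⟨Ge, hsize.of_div hn hs0 hs1 hε hε1 (FBNN.sizeConst_pos d n s).le hC, hpot,
    hhel.mono fun θ hθ => hθ.trans (ENNReal.ofReal_le_ofReal (le_mul_of_one_le_left hε.le hC))⟩
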